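/- Let $d\ge 3$ and $n_1,\dots,n_d\ge 2$, and consider the real tensors $\mathbf T\in\mathbb R^{n_1\times\dots\times n_d}$ with the Frobenius inner product $\langle\cdot,\cdot\rangle$. Let $\|\mathbf T\|_\sigma=\max\{\langle\mathbf T,\mathbf x_1\otimes\dots\otimes\mathbf x_d\rangle:\|\mathbf x_k\|_2=1\ \forall k\}$ be the spectral norm and $\|\mathbf T\|_*=\min\{\sum_i|\lambda_i|:\mathbf T=\sum_{i=1}^r\lambda_i\,\mathbf x_1^i\otimes\dots\otimes\mathbf x_d^i,\ \|\mathbf x_k^i\|_2=1\ \forall i,k,\ r\in\mathbb N\}$ the nuclear norm. Let $\operatorname{sp}_k(\mathbf T)\subseteq\mathbb R^{n_k}$ be the span of the mode-$k$ fibers of $\mathbf T$. For $I\subseteq[d]=\{1,\dots,d\}$ let $\mathbb T^I(\mathbf T)$ be the span of all $\mathbf v_1\otimes\dots\otimes\mathbf v_d$ with $\mathbf v_k\in\operatorname{sp}_k(\mathbf T)^\perp$ for $k\in I$ and $\mathbf v_k\in\operatorname{sp}_k(\mathbf T)$ for $k\notin I$. For a nonempty family $J$ of nonempty subsets of $[d]$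 let $\mathbb X^J(\mathbf T)=\bigoplus_{I\in J}\mathbb T^I(\mathbf T)$, and let $\mathbb U^I(\mathbf T)=\bigoplus_{I\subseteq I'\subseteq[d]}\mathbb T^{I'}(\mathbf T)$. Let $\mathbb Z(\mathbf O)=\{\mathbf O\}$ and, for $\mathbf T\neq\mathbf O$, $\mathbb Z(\mathbf T)=\{\mathbf Z\in\mathbb T^\varnothing(\mathbf T):\langle\mathbf Z,\mathbf T\rangle=\|\mathbf T\|_*,\ \|\mathbf Z\|_\sigma=1\}$. Define $$\underline\tau(\mathbb X^J(\mathbf T))=\sup\{t\in\mathbb R:\|\mathbf Z+\mathbf X\|_\sigma\le1\ \ \forall\,\mathbf Z\in\mathbb Z(\mathbf T),\ \mathbf X\in\mathbb X^J(\mathbf T)\text{ with }\|\mathbf X\|_\sigma\le t\}$$ (which is $+\infty$ if $\mathbb X^J(\mathbf T)=\{\mathbf O\}$), $$\overline\tau(\mathbb X^J(\mathbf T))=\sup\{\|\mathbf X\|_\sigma:\mathbf Z\in\mathbb Z(\mathbf T),\ \mathbf X\in\mathbb X^J(\mathbf T),\ \|\mathbf Z+\mathbf X\|_\sigma\le1\},$$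 and $\underline\tau(\mathbb X^J)=\inf_{\mathbf T}\underline\tau(\mathbb X^J(\mathbf T))$, $\overline\tau(\mathbb X^J)=\sup_{\mathbf T}\overline\tau(\mathbb X^J(\mathbf T))$, over all $\mathbf T\in\mathbb R^{n_1\times\dots\times n_d}$. Write $\mathbb S_m=\bigoplus_{I\subseteq[d],\,|I|\ge m}\mathbb T^I$. Then: 1. $\underline\tau(\mathbb T^I)=0$ and $\overline\tau(\mathbb T^I)=1$ for every $I\subseteq[d]$ with $|I|=1$. 2. $\underline\tau(\mathbb T^I)=\overline\tau(\mathbb T^I)=1$ for every $I\subseteq[d]$ with $|I|\ge2$. 3. $\underline\tau(\mathbb U^I)=0$ and $\overline\tau(\mathbb U^I)=1$ for every $I\subseteq[d]$ with $|I|=1$. 4. $\underline\tau(\mathbb U^I)=\overline\tau(\mathbb U^I)=1$ for every $I\subseteq[d]$ with $|I|\ge2$. 5. If $d=3$: $\frac12\le\underline\tau(\mathbb S_2)\le\frac1{\sqrt3}$ and $\frac2{\sqrt3}\le\overline\tau(\mathbb S_2)\le\frac{1+\sqrt2}2$. 6. If $d=3$: $\underline\tau(\mathbb S_1)=0$ and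 $\frac2{\sqrt3}\le\overline\tau(\mathbb S_1)\le\frac32$. 7. If $d=4$: $\frac13\le\underline\tau(\mathbb S_2)\le\frac12$ and $\frac{1+\sqrt2}2\le\overline\tau(\mathbb S_2)\le\frac{1+\sqrt3}2$. 8. If $d=4$: $\underline\tau(\mathbb S_1)=0$ and $\frac{1+\sqrt2}2\le\overline\tau(\mathbb S_1)\le\frac85$. 9. If $d\ge5$: $\frac2{d(d-1)}\le\underline\tau(\mathbb S_2)\le\frac12$ and $\frac{1+\sqrt2}2\le\overline\tau(\mathbb S_2)\le2$. 10. If $d\ge5$: $\underline\tau(\mathbb S_1)=0$ and $\frac{1+\sqrt2}2\le\overline\tau(\mathbb S_1)\le2$. Moreover, wherever an exact value is given above, the corresponding infimum or supremum over $\mathbf T$ is attained. -/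

import Mathlib

noncomputable section

namespace TensorNuclear

/-- Real tensors of order `d` and dimensions `n 0 × ⋯ × n (d-1)`, as arrays of entries;
the inner product `inner ℝ` is the Frobenius inner product. -/
abbrev Tensor {d : ℕ} (n : Fin d → ℕ) : Type :=
  EuclideanSpace ℝ ((k : Fin d) → Fin (n k))

variable {d : ℕ} {n : Fin d → ℕ}

/-- The outer product `x₁ ⊗ ⋯ ⊗ x_d`. -/
def outer (x : (k : Fin d) → EuclideanSpace ℝ (Fin (n k))) : Tensor n :=
  WithLp.toLp 2 fun i => ∏ k, x k (i k)

/-- The spectral norm `‖T‖_σ`. -/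
def specNorm (T : Tensor n) : ℝ :=
  sSup {r : ℝ | ∃ x : (k : Fin d) → EuclideanSpace ℝ (Fin (n k)),
    (∀ k, ‖x k‖ = 1) ∧ r = inner ℝ T (outer x)}

/-- The nuclear norm `‖T‖_*`. -/
def nucNorm (T : Tensor n) : ℝ :=
  sInf {s : ℝ | ∃ (r : ℕ) (c : Fin r → ℝ)
    (x : Fin r → (k : Fin d) → EuclideanSpace ℝ (Fin (n k))),
    (∀ i k, ‖x i k‖ = 1) ∧ T = ∑ i, c i • outer (x i) ∧ s = ∑ i, |c i|}

/-- The mode-`k` fiber of `T` through the entry `i` (the `k`-th index of `i` is irrelevant). -/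
def fiber (T : Tensor n) (k : Fin d) (i : (k : Fin d) → Fin (n k)) :
    EuclideanSpace ℝ (Fin (n k)) :=
  WithLp.toLp 2 fun j => T (Function.update i k j)

/-- `sp_k(T)`: the span of the mode-`k` fibers of `T`. -/
def modeSpan (T : Tensor n) (k : Fin d) : Submodule ℝ (EuclideanSpace ℝ (Fin (n k))) :=
  Submodule.span ℝ (Set.range (fiber T k))

/-- `𝕋(V₁, …, V_d) = sp(V₁ ⊗ ⋯ ⊗ V_d)`. -/
def tensorSpan (V : (k : Fin d) → Submodule ℝ (EuclideanSpace ℝ (Fin (n k)))) :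
    Submodule ℝ (Tensor n) :=
  Submodule.span ℝ {S | ∃ v : (k : Fin d) → EuclideanSpace ℝ (Fin (n k)),
    (∀ k, v k ∈ V k) ∧ S = outer v}

/-- The basic subspace `𝕋^I(T)`: use `sp_k(T)ᗮ` for `k ∈ I` and `sp_k(T)` for `k ∉ I`. -/
def basicSubspace (T : Tensor n) (I : Finset (Fin d)) : Submodule ℝ (Tensor n) :=
  tensorSpan fun k => if k ∈ I then (modeSpan T k)ᗮ else modeSpan T k

/-- `𝕏^J(T)`: the (orthogonal) sum of the basic subspaces `𝕋^I(T)`, `I ∈ J`. -/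
def sumSubspace (J : Finset (Finset (Fin d))) (T : Tensor n) : Submodule ℝ (Tensor n) :=
  ⨆ I ∈ J, basicSubspace T I

/-- The family of all supersets of `I`; `𝕌^I(T) = 𝕏^(supersets I)(T)`. -/
def supersets (I : Finset (Fin d)) : Finset (Finset (Fin d)) :=
  Finset.univ.filter fun J => I ⊆ J

/-- The family of all `I ⊆ [d]` with `|I| ≥ m`. -/
def cardAtLeast (d m : ℕ) : Finset (Finset (Fin d)) :=
  Finset.univ.filter fun I => m ≤ I.card

/-- `ℤ(T)`: the normalized dual certificates of `T` in `𝕋(T)`, and `{0}` for `T = 0`. -/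
def certificates (T : Tensor n) : Set (Tensor n) :=
  {Z | (T = 0 ∧ Z = 0) ∨
    (T ≠ 0 ∧ Z ∈ basicSubspace T ∅ ∧ inner ℝ Z T = nucNorm T ∧ specNorm Z = 1)}

/-- The guaranteed threshold of `𝕏^J(T)`, an extended real; it is `⊤` when
`𝕏^J(T) = 0`. -/
def lowerTauAt (J : Finset (Finset (Fin d))) (T : Tensor n) : EReal :=
  sSup ((fun t : ℝ => (t : EReal)) '' {t : ℝ | ∀ Z ∈ certificates T, ∀ X ∈ sumSubspace J T,
    specNorm X ≤ t → specNorm (Z + X) ≤ 1})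

/-- The possible threshold of `𝕏^J(T)`. -/
def upperTauAt (J : Finset (Finset (Fin d))) (T : Tensor n) : EReal :=
  sSup ((fun t : ℝ => (t : EReal)) '' {t : ℝ | ∃ Z ∈ certificates T, ∃ X ∈ sumSubspace J T,
    specNorm (Z + X) ≤ 1 ∧ t = specNorm X})

/-- The guaranteed threshold of `𝕏^J` over all tensors of dimensions `n`. -/
def lowerTau (n : Fin d → ℕ) (J : Finset (Finset (Fin d))) : EReal :=
  ⨅ T : Tensor n, lowerTauAt J T

/-- The possible threshold of `𝕏^J` over all tensors of dimensions `n`. -/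
def upperTau (n : Fin d → ℕ) (J : Finset (Finset (Fin d))) : EReal :=
  ⨆ T : Tensor n, upperTauAt J T

/-- The infimum defining `lowerTau n J` is a minimum. -/
def LowerAttained (n : Fin d → ℕ) (J : Finset (Finset (Fin d))) : Prop :=
  ∃ T : Tensor n, lowerTauAt J T = lowerTau n J

/-- The supremum defining `upperTau n J` is a maximum. -/
def UpperAttained (n : Fin d → ℕ) (J : Finset (Finset (Fin d))) : Prop :=
  ∃ T : Tensor n, upperTauAt J T = upperTau n J

end TensorNuclear

end

open TensorNuclear

noncomputable section

namespace TensorNuclear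

variable {d : ℕ} {n : Fin d → ℕ}

/-! Tensors are studied through their multilinear forms. Each unit vector is written x_k = a_k + b_k
with a_k in sp_k(T) and b_k orthogonal to it; the norms c_k = ‖a_k‖ and s_k = ‖b_k‖ satisfy c_k² +
s_k² = 1. A certificate Z sees only the a_k, so |Z(x)| ≤ ∏ c_k, while X in 𝕏^J(T) vanishes on every
choice of a's and b's whose set of b-modes is not in J. Every bound valid for all T thus becomes an
inequality between cosines and sines. Of Z only Z ∈ 𝕋^∅(T) and ‖Z‖_σ ≤ 1 are used.

If all I ∈ J share a mode i, replacing x_i by b_i leaves X(x) unchanged and kills Z, so ‖Z + X‖_σ ≤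
1 forces ‖X‖_σ ≤ 1 (`specNorm_le_of_common_mode`). With two common modes, Z(x) + X(x) ≤ c_i c_j +
s_i s_j ≤ 1 (`specNorm_add_le_of_common_modes`). This settles 𝕋^I and 𝕌^I from one side.

For the possible thresholds of 𝕊_1 and 𝕊_2 there are two bounds on X(x). First, X(x) ≤ 1 + ∏ c_k,
which alone gives 2. Second, expanding mode by mode, each surviving term contains some b_k; there Z
vanishes, X equals Z + X, and the term is at most a product of norms. For orders 3 and 4 the two
bounds are combined by Cauchy-Schwarz. For the guaranteed threshold of 𝕊_2, Z(x) ≤ ∏ c_k is added to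
an expansion of X(x) in which every term contains two b's.

The opposite bounds come from explicit tensors with entries at multi-indices in {0,1}^d, mostly with
T = Z = e₀ ⊗ ⋯ ⊗ e₀. The decisive form is Re ∏ (u_k + i v_k) over 3 or 4 modes: its spectral norm is
at most 1, its term ∏ u_k is Z, and the rest is an X in 𝕊_2 of larger norm. For a single mode a
rank-one T does not reach the value 1, and `pairTensor` is used instead. -/

/-- The multilinear form `x ↦ ⟨S, x₁ ⊗ ⋯ ⊗ x_d⟩` of a tensor `S`. -/
def form (S : Tensor n) :
    MultilinearMap ℝ (fun k : Fin d => EuclideanSpace ℝ (Fin (n k))) ℝ :=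
  ∑ i, S i • (MultilinearMap.mkPiAlgebra ℝ (Fin d) ℝ).compLinearMap
    fun k => (EuclideanSpace.proj (𝕜 := ℝ) (i k)).toLinearMap

theorem form_apply (S : Tensor n) (x : (k : Fin d) → EuclideanSpace ℝ (Fin (n k))) :
    form S x = ∑ i, S i * ∏ k, x k (i k) := by
  simp [form]

theorem inner_outer (S : Tensor n) (x : (k : Fin d) → EuclideanSpace ℝ (Fin (n k))) :
    inner ℝ S (outer x) = form S x := by
  rw [form_apply, PiLp.inner_apply]
  exact Finset.sum_congr rfl fun i _ => by simp [outer, mul_comm]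

theorem form_add (S S' : Tensor n) (x : (k : Fin d) → EuclideanSpace ℝ (Fin (n k))) :
    form (S + S') x = form S x + form S' x := by
  simp only [← inner_outer, inner_add_left]

theorem form_sub (S S' : Tensor n) (x : (k : Fin d) → EuclideanSpace ℝ (Fin (n k))) :
    form (S - S') x = form S x - form S' x := by
  simp only [← inner_outer, inner_sub_left]

theorem form_smul (c : ℝ) (S : Tensor n) (x : (k : Fin d) → EuclideanSpace ℝ (Fin (n k))) :
    form (c • S) x = c * form S x := by
  simp only [← inner_outer, real_inner_smul_left]

theorem form_outer (v x : (k : Fin d) → EuclideanSpace ℝ (Fin (n k))) :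
    form (outer v) x = ∏ k, inner ℝ (v k) (x k) := by
  simp only [form_apply, PiLp.inner_apply, Finset.prod_univ_sum, Fintype.piFinset_univ]
  refine Finset.sum_congr rfl fun i _ => ?_
  simp [outer, Finset.prod_mul_distrib, mul_comm]

/-! ### Bounds of forms by the spectral norm -/

theorem form_le_sum_abs (S : Tensor n) (x : (k : Fin d) → EuclideanSpace ℝ (Fin (n k)))
    (hx : ∀ k, ‖x k‖ = 1) : form S x ≤ ∑ i, |S i| := by
  rw [form_apply]
  refine Finset.sum_le_sum fun i _ => (le_abs_self _).trans ?_
  rw [abs_mul, Finset.abs_prod]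
  refine mul_le_of_le_one_right (abs_nonneg _) ?_
  refine Finset.prod_le_one (fun _ _ => abs_nonneg _) fun k _ => ?_
  have := PiLp.norm_apply_le (x k) (i k)
  rwa [hx k, Real.norm_eq_abs] at this

theorem form_le_specNorm (S : Tensor n) (x : (k : Fin d) → EuclideanSpace ℝ (Fin (n k)))
    (hx : ∀ k, ‖x k‖ = 1) : form S x ≤ specNorm S := by
  refine le_csSup ⟨∑ i, |S i|, ?_⟩ ⟨x, hx, (inner_outer S x).symm⟩
  rintro r ⟨y, hy, rfl⟩
  rw [inner_outer]
  exact form_le_sum_abs S y hy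

/-- The hypothesis `0 ≤ c` covers an empty set of unit families, where `sSup` takes the value 0. -/
theorem specNorm_le {S : Tensor n} {c : ℝ} (hc : 0 ≤ c)
    (h : ∀ x : (k : Fin d) → EuclideanSpace ℝ (Fin (n k)), (∀ k, ‖x k‖ = 1) → form S x ≤ c) :
    specNorm S ≤ c := by
  refine Real.sSup_le ?_ hc
  rintro r ⟨y, hy, rfl⟩
  rw [inner_outer]
  exact h y hy

theorem abs_form_le_specNorm (hd : 0 < d) (S : Tensor n)
    (x : (k : Fin d) → EuclideanSpace ℝ (Fin (n k))) (hx : ∀ k, ‖x k‖ = 1) :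
    |form S x| ≤ specNorm S := by
  refine abs_le'.2 ⟨form_le_specNorm S x hx, ?_⟩
  -- Changing the sign of one vector changes the sign of the form; this needs at least one mode.
  have h := form_le_specNorm S (Function.update x ⟨0, hd⟩ ((-1 : ℝ) • x ⟨0, hd⟩)) fun k => by
    by_cases hk : k = ⟨0, hd⟩
    · subst hk; simp [hx]
    · simp [hk, hx]
  rw [MultilinearMap.map_update_smul] at h
  simpa using h

theorem exists_unit_smul (hn : ∀ k, 2 ≤ n k) (k : Fin d) (y : EuclideanSpace ℝ (Fin (n k))) :
    ∃ u : EuclideanSpace ℝ (Fin (n k)), ‖u‖ = 1 ∧ y = ‖y‖ • u := by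
  by_cases hy : y = 0
  · exact ⟨EuclideanSpace.single ⟨0, by have := hn k; omega⟩ 1, by simp, by simp [hy]⟩
  · have h : ‖y‖ ≠ 0 := norm_ne_zero_iff.2 hy
    exact ⟨‖y‖⁻¹ • y, by simp [norm_smul, h], by rw [smul_smul, mul_inv_cancel₀ h, one_smul]⟩

theorem abs_form_le (hd : 0 < d) (hn : ∀ k, 2 ≤ n k) (S : Tensor n)
    (y : (k : Fin d) → EuclideanSpace ℝ (Fin (n k))) :
    |form S y| ≤ specNorm S * ∏ k, ‖y k‖ := by
  choose u hu hyu using fun k => exists_unit_smul hn k (y k)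
  have h : form S y = (∏ k, ‖y k‖) * form S u := by
    rw [← smul_eq_mul, ← MultilinearMap.map_smul_univ]
    congr 1
    exact funext hyu
  rw [h, abs_mul, abs_of_nonneg (Finset.prod_nonneg fun _ _ => norm_nonneg _), mul_comm]
  exact mul_le_mul_of_nonneg_right (abs_form_le_specNorm hd S u hu)
    (Finset.prod_nonneg fun _ _ => norm_nonneg _)

theorem specNorm_nonneg (hd : 0 < d) (hn : ∀ k, 2 ≤ n k) (S : Tensor n) : 0 ≤ specNorm S := by
  choose u hu _ using fun k => exists_unit_smul hn k (0 : EuclideanSpace ℝ (Fin (n k)))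
  exact (abs_nonneg _).trans (abs_form_le_specNorm hd S u hu)

theorem abs_form_le_of_specNorm_le (hd : 0 < d) (hn : ∀ k, 2 ≤ n k) {S : Tensor n} {M : ℝ}
    (hS : specNorm S ≤ M) (y : (k : Fin d) → EuclideanSpace ℝ (Fin (n k))) :
    |form S y| ≤ M * ∏ k, ‖y k‖ :=
  (abs_form_le hd hn S y).trans
    (mul_le_mul_of_nonneg_right hS (Finset.prod_nonneg fun _ _ => norm_nonneg _))

/-! ### Vanishing of the forms of tensors in `𝕏^J(T)` -/

/-- Each generator `outer v` of 𝕋^I has the form ∏ ⟨v_k, x_k⟩, and one factor pairs orthogonal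
vectors. Hence all of 𝕏^J lies in the orthogonal complement of `outer x`. -/
theorem form_eq_zero_of_mem_sumSubspace {J : Finset (Finset (Fin d))} {T X : Tensor n}
    (hX : X ∈ sumSubspace J T) (x : (k : Fin d) → EuclideanSpace ℝ (Fin (n k)))
    (h : ∀ I ∈ J, ∃ k, (k ∈ I ∧ x k ∈ modeSpan T k) ∨ (k ∉ I ∧ x k ∈ (modeSpan T k)ᗮ)) :
    form X x = 0 := by
  have hle : sumSubspace J T ≤ (Submodule.span ℝ {outer x})ᗮ := by
    refine iSup₂_le fun I hI => Submodule.span_le.2 ?_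
    rintro S ⟨v, hv, rfl⟩
    obtain ⟨k, hk⟩ := h I hI
    rw [SetLike.mem_coe, Submodule.mem_orthogonal_singleton_iff_inner_left, inner_outer,
      form_outer]
    refine Finset.prod_eq_zero (Finset.mem_univ k) ?_
    have hvk := hv k
    rcases hk with ⟨h1, h2⟩ | ⟨h1, h2⟩
    · simp only [if_pos h1] at hvk
      exact Submodule.inner_left_of_mem_orthogonal h2 hvk
    · simp only [if_neg h1] at hvk
      exact Submodule.inner_right_of_mem_orthogonal hvk h2
  have := hle hX
  rwa [Submodule.mem_orthogonal_singleton_iff_inner_left, inner_outer] at this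

theorem form_eq_zero_of_mem_basicSubspace_empty {T Z : Tensor n}
    (hZ : Z ∈ basicSubspace T ∅) (x : (k : Fin d) → EuclideanSpace ℝ (Fin (n k)))
    (h : ∃ k, x k ∈ (modeSpan T k)ᗮ) : form Z x = 0 := by
  have hZ' : Z ∈ sumSubspace {∅} T := by simpa [sumSubspace] using hZ
  refine form_eq_zero_of_mem_sumSubspace hZ' x fun I hI => ?_
  obtain ⟨k, hk⟩ := h
  rw [Finset.mem_singleton] at hI
  exact ⟨k, Or.inr ⟨by simp [hI], hk⟩⟩

/-- The two properties of a certificate on which all universal bounds rest; they also cover T = 0.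
-/
theorem mem_and_specNorm_le_of_mem_certificates {T Z : Tensor n} (hZ : Z ∈ certificates T) :
    Z ∈ basicSubspace T ∅ ∧ specNorm Z ≤ 1 := by
  rcases hZ with ⟨-, rfl⟩ | ⟨-, h1, -, h2⟩
  · refine ⟨Submodule.zero_mem _, specNorm_le zero_le_one fun x _ => ?_⟩
    simp [← inner_outer]
  · exact ⟨h1, h2.le⟩

theorem exists_split (T : Tensor n) (x : (k : Fin d) → EuclideanSpace ℝ (Fin (n k)))
    (hx : ∀ k, ‖x k‖ = 1) :
    ∃ a b : (k : Fin d) → EuclideanSpace ℝ (Fin (n k)), (x = fun k => a k + b k) ∧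
      (∀ k, a k ∈ modeSpan T k) ∧ (∀ k, b k ∈ (modeSpan T k)ᗮ) ∧
      ∀ k, ‖a k‖ ^ 2 + ‖b k‖ ^ 2 = 1 := by
  refine ⟨fun k => (modeSpan T k).starProjection (x k),
    fun k => (modeSpan T k)ᗮ.starProjection (x k), ?_, fun k => ?_, fun k => ?_, fun k => ?_⟩
  · funext k
    exact ((modeSpan T k).starProjection_add_starProjection_orthogonal (x k)).symm
  · exact Submodule.starProjection_apply_mem _ _
  · exact Submodule.starProjection_apply_mem _ _
  · have := Submodule.norm_sq_eq_add_norm_sq_starProjection (x k) (modeSpan T k)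
    rw [← this, hx k, one_pow]

/-! ### Reduction of the thresholds -/

theorem le_lowerTauAt {J : Finset (Finset (Fin d))} {T : Tensor n} {t : ℝ}
    (h : ∀ Z ∈ basicSubspace T ∅, specNorm Z ≤ 1 → ∀ X ∈ sumSubspace J T,
      specNorm X ≤ t → specNorm (Z + X) ≤ 1) : (t : EReal) ≤ lowerTauAt J T :=
  le_sSup ⟨t, fun Z hZ X hX ht =>
    h Z (mem_and_specNorm_le_of_mem_certificates hZ).1
      (mem_and_specNorm_le_of_mem_certificates hZ).2 X hX ht, rfl⟩

theorem upperTauAt_le {J : Finset (Finset (Fin d))} {T : Tensor n} {t : ℝ}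
    (h : ∀ Z ∈ basicSubspace T ∅, specNorm Z ≤ 1 → ∀ X ∈ sumSubspace J T,
      specNorm (Z + X) ≤ 1 → specNorm X ≤ t) : upperTauAt J T ≤ (t : EReal) := by
  refine sSup_le ?_
  rintro _ ⟨_, ⟨Z, hZ, X, hX, hS, rfl⟩, rfl⟩
  exact EReal.coe_le_coe_iff.2 (h Z (mem_and_specNorm_le_of_mem_certificates hZ).1
      (mem_and_specNorm_le_of_mem_certificates hZ).2 X hX hS)

theorem lowerTauAt_le {J : Finset (Finset (Fin d))} {T : Tensor n} {t₀ : ℝ}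
    (h : ∀ t > t₀, ∃ Z ∈ certificates T, ∃ X ∈ sumSubspace J T,
      specNorm X ≤ t ∧ 1 < specNorm (Z + X)) : lowerTauAt J T ≤ (t₀ : EReal) := by
  refine sSup_le ?_
  rintro _ ⟨t, ht, rfl⟩
  refine EReal.coe_le_coe_iff.2 (not_lt.1 fun hlt => ?_)
  obtain ⟨Z, hZ, X, hX, hXt, h1⟩ := h t hlt
  exact absurd (ht Z hZ X hX hXt) (not_le.2 h1)

theorem le_upperTauAt {J : Finset (Finset (Fin d))} {T Z X : Tensor n} {t : ℝ}
    (hZ : Z ∈ certificates T) (hX : X ∈ sumSubspace J T) (hS : specNorm (Z + X) ≤ 1)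
    (ht : t ≤ specNorm X) : (t : EReal) ≤ upperTauAt J T :=
  (EReal.coe_le_coe_iff.2 ht).trans (le_sSup ⟨_, ⟨Z, hZ, X, hX, hS, rfl⟩, rfl⟩)

/-- One tensor that reaches the universal bound gives both the value and its attainment. -/
theorem lowerTau_eq_and_attained {J : Finset (Finset (Fin d))} {v : EReal} (T : Tensor n)
    (h₁ : ∀ T : Tensor n, v ≤ lowerTauAt J T) (h₂ : lowerTauAt J T ≤ v) :
    lowerTau n J = v ∧ LowerAttained n J := by
  have h : lowerTau n J = v := le_antisymm ((iInf_le _ T).trans h₂) (le_iInf h₁)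
  exact ⟨h, T, (le_antisymm h₂ (h₁ T)).trans h.symm⟩

theorem upperTau_eq_and_attained {J : Finset (Finset (Fin d))} {v : EReal} (T : Tensor n)
    (h₁ : ∀ T : Tensor n, upperTauAt J T ≤ v) (h₂ : v ≤ upperTauAt J T) :
    upperTau n J = v ∧ UpperAttained n J := by
  have h : upperTau n J = v := le_antisymm (iSup_le h₁) (h₂.trans (le_iSup _ T))
  exact ⟨h, T, (le_antisymm (h₁ T) h₂).trans h.symm⟩

/-! ### Monotonicity in the family J, and nonnegativity of the guaranteed threshold -/

theorem sumSubspace_mono {J J' : Finset (Finset (Fin d))} (h : J ⊆ J') (T : Tensor n) :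
    sumSubspace J T ≤ sumSubspace J' T :=
  biSup_mono fun _ hI => h hI

theorem lowerTauAt_anti {J J' : Finset (Finset (Fin d))} (h : J ⊆ J') (T : Tensor n) :
    lowerTauAt J' T ≤ lowerTauAt J T :=
  sSup_le_sSup (Set.image_mono fun _ ht Z hZ X hX => ht Z hZ X (sumSubspace_mono h T hX))

theorem upperTauAt_mono {J J' : Finset (Finset (Fin d))} (h : J ⊆ J') (T : Tensor n) :
    upperTauAt J T ≤ upperTauAt J' T := by
  refine sSup_le_sSup (Set.image_mono ?_)
  rintro _ ⟨Z, hZ, X, hX, h'⟩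
  exact ⟨Z, hZ, X, sumSubspace_mono h T hX, h'⟩

theorem upperTau_mono {J J' : Finset (Finset (Fin d))} (h : J ⊆ J') :
    upperTau n J ≤ upperTau n J' :=
  iSup_mono fun T => upperTauAt_mono h T

/-- The entries of X are the values of its form on standard basis vectors. -/
theorem eq_zero_of_specNorm_le_zero (hd : 0 < d) (hn : ∀ k, 2 ≤ n k) {X : Tensor n}
    (hX : specNorm X ≤ 0) : X = 0 := by
  ext i
  have h := abs_form_le_of_specNorm_le hd hn hX fun k => EuclideanSpace.single (i k) 1
  rw [zero_mul, abs_nonpos_iff, form_apply, Finset.sum_eq_single i] at h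
  · simpa using h
  · intro j _ hj
    obtain ⟨k, hk⟩ := Function.ne_iff.1 hj
    rw [Finset.prod_eq_zero (Finset.mem_univ k), mul_zero]
    simp [hk]
  · simp

theorem zero_le_lowerTauAt (hd : 0 < d) (hn : ∀ k, 2 ≤ n k) (J : Finset (Finset (Fin d)))
    (T : Tensor n) : 0 ≤ lowerTauAt J T := by
  rw [← EReal.coe_zero]
  refine le_lowerTauAt fun Z _ hZ1 X _ hX => ?_
  rw [eq_zero_of_specNorm_le_zero hd hn hX, add_zero]
  exact hZ1

/-! ### Families of sets with common elements -/

theorem prod_univ_le_prod {f : Fin d → ℝ} (h0 : ∀ k, 0 ≤ f k) (h1 : ∀ k, f k ≤ 1)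
    (s : Finset (Fin d)) : ∏ k, f k ≤ ∏ k ∈ s, f k := by
  rw [← Finset.prod_mul_prod_compl s]
  exact mul_le_of_le_one_right (Finset.prod_nonneg fun k _ => h0 k)
    (Finset.prod_le_one (fun k _ => h0 k) fun k _ => h1 k)

theorem prod_le_mul_of_ne {f : Fin d → ℝ} (h0 : ∀ k, 0 ≤ f k) (h1 : ∀ k, f k ≤ 1) {i j : Fin d}
    (hij : i ≠ j) : ∏ k, f k ≤ f i * f j := by
  rw [← Finset.prod_pair hij]
  exact prod_univ_le_prod h0 h1 _

theorem norm_update_le_one {x : (k : Fin d) → EuclideanSpace ℝ (Fin (n k))}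
    (hx : ∀ k, ‖x k‖ ≤ 1) {i : Fin d} {u : EuclideanSpace ℝ (Fin (n i))} (hu : ‖u‖ ≤ 1)
    (k : Fin d) : ‖Function.update x i u k‖ ≤ 1 := by
  by_cases hk : k = i
  · subst hk; simpa using hu
  · simpa [hk] using hx k

theorem form_split (S : Tensor n) (x : (k : Fin d) → EuclideanSpace ℝ (Fin (n k))) (i : Fin d)
    {u v : EuclideanSpace ℝ (Fin (n i))} (h : x i = u + v) :
    form S x = form S (Function.update x i u) + form S (Function.update x i v) := by
  rw [← MultilinearMap.map_update_add, ← h, Function.update_eq_self]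

theorem form_eq_update_perp {J : Finset (Finset (Fin d))} {T X : Tensor n}
    (hX : X ∈ sumSubspace J T) {i : Fin d} (hi : ∀ I ∈ J, i ∈ I)
    (x : (k : Fin d) → EuclideanSpace ℝ (Fin (n k))) {a b : EuclideanSpace ℝ (Fin (n i))}
    (h : x i = a + b) (ha : a ∈ modeSpan T i) : form X x = form X (Function.update x i b) := by
  rw [form_split X x i h, form_eq_zero_of_mem_sumSubspace hX, zero_add]
  exact fun I hI => ⟨i, Or.inl ⟨hi I hI, by simpa using ha⟩⟩

theorem form_eq_update_span {T Z : Tensor n} (hZ : Z ∈ basicSubspace T ∅) {i : Fin d}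
    (x : (k : Fin d) → EuclideanSpace ℝ (Fin (n k))) {a b : EuclideanSpace ℝ (Fin (n i))}
    (h : x i = a + b) (hb : b ∈ (modeSpan T i)ᗮ) :
    form Z x = form Z (Function.update x i a) := by
  rw [form_split Z x i h, form_eq_zero_of_mem_basicSubspace_empty hZ (Function.update x i b),
    add_zero]
  exact ⟨i, by simpa using hb⟩

/-- With x_i replaced by b_i, the form of X is unchanged and that of Z vanishes, so X inherits the
bound on Z + X. -/
theorem specNorm_le_of_common_mode (hd : 0 < d) (hn : ∀ k, 2 ≤ n k)
    {J : Finset (Finset (Fin d))} {i : Fin d} (hi : ∀ I ∈ J, i ∈ I) {T Z X : Tensor n}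
    (hZ : Z ∈ basicSubspace T ∅) (hX : X ∈ sumSubspace J T) (hS : specNorm (Z + X) ≤ 1) :
    specNorm X ≤ 1 := by
  refine specNorm_le zero_le_one fun x hx => ?_
  obtain ⟨a, b, rfl, ha, hb, hab⟩ := exists_split T x hx
  rw [form_eq_update_perp hX hi _ rfl (ha i)]
  have h0 : form Z (Function.update (fun k => a k + b k) i (b i)) = 0 :=
    form_eq_zero_of_mem_basicSubspace_empty hZ _ ⟨i, by simpa using hb i⟩
  have h1 := abs_form_le_of_specNorm_le hd hn hS (Function.update (fun k => a k + b k) i (b i))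
  rw [form_add, h0, zero_add, one_mul] at h1
  refine (le_abs_self _).trans (h1.trans (Finset.prod_le_one (fun _ _ => norm_nonneg _) ?_))
  refine fun k _ => norm_update_le_one (fun k => (hx k).le) ?_ k
  nlinarith [hab i, norm_nonneg (b i), sq_nonneg ‖a i‖]

/-- In the modes i and j, Z sees only a_i, a_j and X sees only b_i, b_j. The sum is therefore at
most c_i c_j + s_i s_j ≤ 1. -/
theorem specNorm_add_le_of_common_modes (hd : 0 < d) (hn : ∀ k, 2 ≤ n k)
    {J : Finset (Finset (Fin d))} {i j : Fin d} (hij : i ≠ j) (hi : ∀ I ∈ J, i ∈ I)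
    (hj : ∀ I ∈ J, j ∈ I) {T Z X : Tensor n} (hZ : Z ∈ basicSubspace T ∅)
    (hZ1 : specNorm Z ≤ 1) (hX : X ∈ sumSubspace J T) (hX1 : specNorm X ≤ 1) :
    specNorm (Z + X) ≤ 1 := by
  refine specNorm_le zero_le_one fun x hx => ?_
  obtain ⟨a, b, rfl, ha, hb, hab⟩ := exists_split T x hx
  have key : ∀ S : Tensor n, specNorm S ≤ 1 → ∀ (u : EuclideanSpace ℝ (Fin (n i)))
      (v : EuclideanSpace ℝ (Fin (n j))), ‖u‖ ≤ 1 → ‖v‖ ≤ 1 →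
      form S (Function.update (Function.update (fun k => a k + b k) i u) j v) ≤ ‖u‖ * ‖v‖ := by
    intro S hS u v hu hv
    refine (le_abs_self _).trans ((abs_form_le_of_specNorm_le hd hn hS _).trans ?_)
    rw [one_mul]
    refine (prod_le_mul_of_ne (fun _ => norm_nonneg _)
      (norm_update_le_one (norm_update_le_one (fun k => (hx k).le) hu) hv) hij).trans ?_
    simp [hij]
  rw [form_add, form_eq_update_perp hX hi _ rfl (ha i),
    form_eq_update_perp hX hj _ (Function.update_of_ne hij.symm _ _) (ha j),
    form_eq_update_span hZ _ rfl (hb i),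
    form_eq_update_span hZ _ (Function.update_of_ne hij.symm _ _) (hb j)]
  have h1 : ∀ k, ‖a k‖ ≤ 1 := fun k => by nlinarith [hab k, norm_nonneg (a k), sq_nonneg ‖b k‖]
  have h2 : ∀ k, ‖b k‖ ≤ 1 := fun k => by nlinarith [hab k, norm_nonneg (b k), sq_nonneg ‖a k‖]
  have h3 := key Z hZ1 (a i) (a j) (h1 i) (h1 j)
  have h4 := key X hX1 (b i) (b j) (h2 i) (h2 j)
  nlinarith [hab i, hab j, sq_nonneg (‖a i‖ - ‖a j‖), sq_nonneg (‖b i‖ - ‖b j‖)]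

/-! ### Splitting a form along patterns -/

/-- The vector family that takes `a k`, `b k` or `a k + b k` according to `p k = 0, 1, 2`. -/
def select (a b : (k : Fin d) → EuclideanSpace ℝ (Fin (n k))) (p : Fin d → Fin 3) (k : Fin d) :
    EuclideanSpace ℝ (Fin (n k)) :=
  if p k = 0 then a k else if p k = 1 then b k else a k + b k

/-- One step of the multilinear expansion: the unsplit mode i (value 2) is replaced by its a-part
(value 0) plus its b-part (value 1). For concrete patterns the hypothesis is decidable. -/
theorem form_select_split (S : Tensor n) (a b : (k : Fin d) → EuclideanSpace ℝ (Fin (n k)))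
    (p q r : Fin d → Fin 3) (i : Fin d)
    (h : ∀ k, if k = i then p k = 2 ∧ q k = 0 ∧ r k = 1 else q k = p k ∧ r k = p k) :
    form S (select a b p) = form S (select a b q) + form S (select a b r) := by
  have hi := h i
  rw [if_pos rfl] at hi
  have hp : select a b p i = a i + b i := by simp [select, hi.1]
  rw [form_split S _ i hp]
  congr 2 <;> funext k <;> have hk := h k <;> by_cases hki : k = i
  · subst hki; simp [select, hi.2.1]
  · rw [if_neg hki] at hk; simp [select, hki, hk.1]
  · subst hki; simp [select, hi.2.2]
  · rw [if_neg hki] at hk; simp [select, hki, hk.2]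

/-- The norm of `select a b p k` when `‖a k‖ = c k`, `‖b k‖ = s k` and `‖a k + b k‖ = 1`. -/
def weight (c s : Fin d → ℝ) (p : Fin d → Fin 3) (k : Fin d) : ℝ :=
  if p k = 0 then c k else if p k = 1 then s k else 1

theorem abs_form_select_le (hd : 0 < d) (hn : ∀ k, 2 ≤ n k) {S : Tensor n} {M : ℝ}
    (hS : specNorm S ≤ M) {a b : (k : Fin d) → EuclideanSpace ℝ (Fin (n k))}
    (hx : ∀ k, ‖a k + b k‖ = 1) (p : Fin d → Fin 3) :
    |form S (select a b p)| ≤ M * ∏ k, weight (fun k => ‖a k‖) (fun k => ‖b k‖) p k := by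
  refine (abs_form_le_of_specNorm_le hd hn hS _).trans (le_of_eq ?_)
  congr 1
  refine Finset.prod_congr rfl fun k _ => ?_
  unfold select weight
  split_ifs
  · rfl
  · rfl
  · exact hx k

/-- For a fully split pattern the set of b-modes is the only I for which 𝕋^I can contribute. -/
theorem form_select_eq_zero {J : Finset (Finset (Fin d))} {T X : Tensor n}
    (hX : X ∈ sumSubspace J T) {a b : (k : Fin d) → EuclideanSpace ℝ (Fin (n k))}
    (ha : ∀ k, a k ∈ modeSpan T k) (hb : ∀ k, b k ∈ (modeSpan T k)ᗮ) (p : Fin d → Fin 3)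
    (h2 : ∀ k, p k ≠ 2) (hp : Finset.univ.filter (fun k => p k = 1) ∉ J) :
    form X (select a b p) = 0 := by
  refine form_eq_zero_of_mem_sumSubspace hX _ fun I hI => ?_
  have hne : I ≠ Finset.univ.filter (fun k => p k = 1) := fun h => hp (h ▸ hI)
  by_contra hcon
  push Not at hcon
  refine hne (Finset.ext fun k => ?_)
  have hk := hcon k
  have hp2 := h2 k
  rw [Finset.mem_filter]
  by_cases h1 : p k = 1
  · have hs : select a b p k = b k := by simp [select, h1]
    rw [hs] at hk
    by_cases hkI : k ∈ I
    · simp [h1, hkI]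
    · exact absurd (hb k) (hk.2 hkI)
  · have h0 : p k = 0 := by omega
    have hs : select a b p k = a k := by simp [select, h0]
    rw [hs] at hk
    by_cases hkI : k ∈ I
    · exact absurd (ha k) (hk.1 hkI)
    · simp [h1, hkI]

theorem form_select_eq_zero_of_one {T Z : Tensor n} (hZ : Z ∈ basicSubspace T ∅)
    {a b : (k : Fin d) → EuclideanSpace ℝ (Fin (n k))} (hb : ∀ k, b k ∈ (modeSpan T k)ᗮ)
    (p : Fin d → Fin 3) (h : ∃ k, p k = 1) : form Z (select a b p) = 0 := by
  refine form_eq_zero_of_mem_basicSubspace_empty hZ _ ?_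
  obtain ⟨k, hk⟩ := h
  exact ⟨k, by simpa [select, hk] using hb k⟩

/-! ### Trigonometric inequalities -/

/-- If f > 3/2, the first bound makes c₀c₁c₂ > 1/2. The three summands of the second have squares
adding up to 1 - (c₀c₁c₂)² < 3/4, so by Cauchy-Schwarz their sum is below 3/2. -/
theorem le_three_halves {f c₀ c₁ c₂ s₀ s₁ s₂ : ℝ} (h₀ : c₀ ^ 2 + s₀ ^ 2 = 1)
    (h₁ : c₁ ^ 2 + s₁ ^ 2 = 1) (h₂ : c₂ ^ 2 + s₂ ^ 2 = 1) (hf : f ≤ 1 + c₀ * c₁ * c₂)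
    (hf' : f ≤ s₀ + c₀ * s₁ + c₀ * c₁ * s₂) : f ≤ 3 / 2 := by
  by_contra! hcon
  have hp : 1 / 2 < c₀ * c₁ * c₂ := by linarith
  have e : s₀ ^ 2 + (c₀ * s₁) ^ 2 + (c₀ * c₁ * s₂) ^ 2 = 1 - (c₀ * c₁ * c₂) ^ 2 := by
    linear_combination h₀ + c₀ ^ 2 * h₁ + c₀ ^ 2 * c₁ ^ 2 * h₂
  nlinarith [sq_nonneg (s₀ - c₀ * s₁), sq_nonneg (s₀ - c₀ * c₁ * s₂),
    sq_nonneg (c₀ * s₁ - c₀ * c₁ * s₂)]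

/-- As for three modes: now the product exceeds 3/5, and four summands with squares adding up to
less than 16/25 have a sum below 8/5. -/
theorem le_eight_fifths {f c₀ c₁ c₂ c₃ s₀ s₁ s₂ s₃ : ℝ} (h₀ : c₀ ^ 2 + s₀ ^ 2 = 1)
    (h₁ : c₁ ^ 2 + s₁ ^ 2 = 1) (h₂ : c₂ ^ 2 + s₂ ^ 2 = 1) (h₃ : c₃ ^ 2 + s₃ ^ 2 = 1)
    (hf : f ≤ 1 + c₀ * c₁ * c₂ * c₃)
    (hf' : f ≤ s₀ + c₀ * s₁ + c₀ * c₁ * s₂ + c₀ * c₁ * c₂ * s₃) : f ≤ 8 / 5 := by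
  by_contra! hcon
  have hp : 3 / 5 < c₀ * c₁ * c₂ * c₃ := by linarith
  have e : s₀ ^ 2 + (c₀ * s₁) ^ 2 + (c₀ * c₁ * s₂) ^ 2 + (c₀ * c₁ * c₂ * s₃) ^ 2 =
      1 - (c₀ * c₁ * c₂ * c₃) ^ 2 := by
    linear_combination h₀ + c₀ ^ 2 * h₁ + c₀ ^ 2 * c₁ ^ 2 * h₂ + c₀ ^ 2 * c₁ ^ 2 * c₂ ^ 2 * h₃
  generalize c₀ * c₁ * c₂ * c₃ = p at *
  generalize c₀ * c₁ * c₂ * s₃ = z at *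
  generalize c₀ * c₁ * s₂ = y at *
  generalize c₀ * s₁ = w at *
  nlinarith [sq_nonneg (s₀ - w), sq_nonneg (s₀ - y), sq_nonneg (s₀ - z), sq_nonneg (w - y),
    sq_nonneg (w - z), sq_nonneg (y - z)]

/-- The second bound is at most √2 - c₀c₁c₂, so averaging it with the first eliminates the product.
With q = c₀c₁, Cauchy-Schwarz bounds its square by (1 - q²)(2 - c₂²), which is (√2 - q c₂)² - (c₂ -
√2 q)². -/
theorem le_one_add_sqrt_two_div_two {f c₀ c₁ c₂ s₀ s₁ s₂ : ℝ} (h₀ : c₀ ^ 2 + s₀ ^ 2 = 1)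
    (h₁ : c₁ ^ 2 + s₁ ^ 2 = 1) (h₂ : c₂ ^ 2 + s₂ ^ 2 = 1) (hp : c₀ * c₁ * c₂ ≤ 1)
    (hf : f ≤ 1 + c₀ * c₁ * c₂) (hf' : f ≤ s₀ + c₀ * s₁ * s₂) : f ≤ (1 + √2) / 2 := by
  have r : √2 ^ 2 = 2 := Real.sq_sqrt (by norm_num)
  have r1 : 1 ≤ √2 := Real.one_le_sqrt.2 (by norm_num)
  have e : s₀ ^ 2 + (c₀ * s₁) ^ 2 = 1 - (c₀ * c₁) ^ 2 := by
    linear_combination h₀ + c₀ ^ 2 * h₁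
  have e2 : s₂ ^ 2 = 1 - c₂ ^ 2 := by linarith
  have cs : (s₀ + c₀ * s₁ * s₂) ^ 2 ≤ (s₀ ^ 2 + (c₀ * s₁) ^ 2) * (1 + s₂ ^ 2) := by
    nlinarith [sq_nonneg (s₀ * s₂ - c₀ * s₁)]
  rw [e, e2] at cs
  have h := abs_le_of_sq_le_sq (a := s₀ + c₀ * s₁ * s₂) (b := √2 - c₀ * c₁ * c₂)
    (by nlinarith [sq_nonneg (c₂ - √2 * (c₀ * c₁))]) (by linarith)
  linarith [(abs_le.1 h).2]

theorem le_one_add_sqrt_three_div_two {f c₀ c₁ c₂ c₃ s₀ s₁ s₂ s₃ : ℝ}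
    (h₀ : c₀ ^ 2 + s₀ ^ 2 = 1) (h₁ : c₁ ^ 2 + s₁ ^ 2 = 1) (h₂ : c₂ ^ 2 + s₂ ^ 2 = 1)
    (h₃ : c₃ ^ 2 + s₃ ^ 2 = 1) (hp : c₀ * c₁ * c₂ * c₃ ≤ 1) (hf : f ≤ 1 + c₀ * c₁ * c₂ * c₃)
    (hf' : f ≤ s₀ + c₀ * s₁ + c₀ * c₁ * s₂ * s₃) : f ≤ (1 + √3) / 2 := by
  have r : √3 ^ 2 = 3 := Real.sq_sqrt (by norm_num)
  have r1 : 1 ≤ √3 := Real.one_le_sqrt.2 (by norm_num)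
  have e : s₀ ^ 2 + (c₀ * s₁) ^ 2 + (c₀ * c₁ * s₂) ^ 2 = 1 - (c₀ * c₁ * c₂) ^ 2 := by
    linear_combination h₀ + c₀ ^ 2 * h₁ + c₀ ^ 2 * c₁ ^ 2 * h₂
  have e2 : s₃ ^ 2 = 1 - c₃ ^ 2 := by linarith
  generalize c₀ * c₁ * c₂ = q at *
  generalize c₀ * c₁ * s₂ = y at *
  generalize c₀ * s₁ = w at *
  have cs : (s₀ + w + y * s₃) ^ 2 ≤ (s₀ ^ 2 + w ^ 2 + y ^ 2) * (2 + s₃ ^ 2) := by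
    nlinarith [sq_nonneg (s₀ - w), sq_nonneg (s₀ * s₃ - y), sq_nonneg (w * s₃ - y)]
  rw [e, e2] at cs
  have h := abs_le_of_sq_le_sq (a := s₀ + w + y * s₃) (b := √3 - q * c₃)
    (by nlinarith [sq_nonneg (c₃ - √3 * q)]) (by linarith)
  linarith [(abs_le.1 h).2]

/-- With p = c₀c₁, q = s₀s₁ and w = s₀c₁ + c₀s₁, Cauchy-Schwarz in (c₂, s₂) reduces the claim to p²
+ w²/4 ≤ (1 - q/2)². This follows from w² = 1 - (p - q)² and p + q ≤ 1. -/
theorem add_half_le_one {c₀ c₁ c₂ s₀ s₁ s₂ : ℝ} (h₀ : c₀ ^ 2 + s₀ ^ 2 = 1)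
    (h₁ : c₁ ^ 2 + s₁ ^ 2 = 1) (h₂ : c₂ ^ 2 + s₂ ^ 2 = 1) (hc₀ : 0 ≤ c₀) (hc₁ : 0 ≤ c₁)
    (hs₀ : 0 ≤ s₀) (hs₁ : 0 ≤ s₁) :
    c₀ * c₁ * c₂ + 1 / 2 * (s₀ * s₁ + s₀ * c₁ * s₂ + c₀ * s₁ * s₂) ≤ 1 := by
  have hp : 0 ≤ c₀ * c₁ := mul_nonneg hc₀ hc₁
  have hq : 0 ≤ s₀ * s₁ := mul_nonneg hs₀ hs₁
  have hpq : c₀ * c₁ + s₀ * s₁ ≤ 1 := by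
    nlinarith [sq_nonneg (c₀ - c₁), sq_nonneg (s₀ - s₁)]
  have e : (s₀ * c₁ + c₀ * s₁) ^ 2 = 1 - (c₀ * c₁ - s₀ * s₁) ^ 2 := by
    linear_combination h₀ * (c₁ ^ 2 + s₁ ^ 2) + h₁
  have e' : c₀ * c₁ * c₂ + 1 / 2 * (s₀ * s₁ + s₀ * c₁ * s₂ + c₀ * s₁ * s₂) =
      1 / 2 * (s₀ * s₁) + (c₀ * c₁ * c₂ + 1 / 2 * (s₀ * c₁ + c₀ * s₁) * s₂) := by ring
  rw [e']
  generalize c₀ * c₁ = p at *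
  generalize s₀ * s₁ = q at *
  generalize s₀ * c₁ + c₀ * s₁ = w at *
  have cs : (p * c₂ + 1 / 2 * w * s₂) ^ 2 ≤ p ^ 2 + 1 / 4 * w ^ 2 := by
    have e₁ : p ^ 2 + 1 / 4 * w ^ 2 - (p * c₂ + 1 / 2 * w * s₂) ^ 2 =
        (p * s₂ - 1 / 2 * w * c₂) ^ 2 := by
      linear_combination -(p ^ 2 + 1 / 4 * w ^ 2) * h₂
    linarith [sq_nonneg (p * s₂ - 1 / 2 * w * c₂)]
  have e₂ : (1 - 1 / 2 * q) ^ 2 - (p ^ 2 + 1 / 4 * w ^ 2) =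
      1 / 4 * q ^ 2 + (1 - (p + q)) * (3 / 2 * p + 3 / 4 * (1 - (p + q)) + 1 / 2 * q) := by
    rw [e]; ring
  have e₃ : 0 ≤ (1 - (p + q)) * (3 / 2 * p + 3 / 4 * (1 - (p + q)) + 1 / 2 * q) :=
    mul_nonneg (by linarith) (by linarith)
  have h := abs_le_of_sq_le_sq (a := p * c₂ + 1 / 2 * w * s₂) (b := 1 - 1 / 2 * q)
    (by linarith [sq_nonneg q]) (by linarith)
  linarith [(abs_le.1 h).2]

theorem mul_add_mul_le_one {c c' s s' : ℝ} (h : c ^ 2 + s ^ 2 ≤ 1) (h' : c' ^ 2 + s' ^ 2 ≤ 1) :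
    c * c' + s * s' ≤ 1 := by
  nlinarith [sq_nonneg (c - c'), sq_nonneg (s - s')]

/-- The six terms belong to the six pairs of modes. They are grouped by the three perfect matchings
of four modes; each group together with c₀c₁c₂c₃ is at most 1, and the three inequalities are
averaged. -/
theorem add_third_le_one {c₀ c₁ c₂ c₃ s₀ s₁ s₂ s₃ : ℝ} (h₀ : c₀ ^ 2 + s₀ ^ 2 = 1)
    (h₁ : c₁ ^ 2 + s₁ ^ 2 = 1) (h₂ : c₂ ^ 2 + s₂ ^ 2 = 1) (h₃ : c₃ ^ 2 + s₃ ^ 2 = 1)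
    (hc₀ : 0 ≤ c₀) (hc₁ : 0 ≤ c₁) (hc₂ : 0 ≤ c₂) (hc₃ : 0 ≤ c₃)
    (hs₀ : 0 ≤ s₀) (hs₁ : 0 ≤ s₁) (hs₂ : 0 ≤ s₂) (hs₃ : 0 ≤ s₃) :
    c₀ * c₁ * c₂ * c₃ + 1 / 3 * (s₀ * s₁ + s₀ * c₁ * s₂ + c₀ * s₁ * s₃ + s₀ * c₁ * c₂ * s₃ +
      c₀ * s₁ * s₂ * c₃ + c₀ * c₁ * s₂ * s₃) ≤ 1 := by
  have m₁ : c₀ * c₁ * c₂ * c₃ + (s₀ * s₁ + c₀ * c₁ * s₂ * s₃) ≤ 1 := by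
    have := mul_add_mul_le_one h₂.le h₃.le
    have := mul_add_mul_le_one h₀.le h₁.le
    nlinarith [mul_nonneg hc₀ hc₁]
  have m₂ : c₀ * c₁ * c₂ * c₃ + (s₀ * c₁ * s₂ + c₀ * s₁ * s₃) ≤ 1 := by
    have e : (c₁ * c₂) ^ 2 + s₁ ^ 2 + (c₁ * s₂) ^ 2 = 1 := by
      linear_combination c₁ ^ 2 * h₂ + h₁
    have cs : (c₁ * c₂ * c₃ + s₁ * s₃) ^ 2 ≤ ((c₁ * c₂) ^ 2 + s₁ ^ 2) * (c₃ ^ 2 + s₃ ^ 2) := by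
      nlinarith [sq_nonneg (c₁ * c₂ * s₃ - s₁ * c₃)]
    rw [h₃] at cs
    have := mul_add_mul_le_one (c := c₀) (s := s₀) (c' := c₁ * c₂ * c₃ + s₁ * s₃)
      (s' := c₁ * s₂) h₀.le (by linarith)
    nlinarith
  have m₃ : c₀ * c₁ * c₂ * c₃ + (s₀ * c₁ * c₂ * s₃ + c₀ * s₁ * s₂ * c₃) ≤ 1 := by
    have e₁ := mul_add_mul_le_one h₁.le h₂.le
    have e₂ := mul_add_mul_le_one h₀.le h₃.le
    have p₁ := mul_nonneg hc₁ hc₂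
    have p₂ := mul_nonneg hc₀ hc₃
    have p₃ := mul_nonneg hs₁ hs₂
    have p₄ := mul_nonneg hs₀ hs₃
    have e : c₀ * c₁ * c₂ * c₃ + (s₀ * c₁ * c₂ * s₃ + c₀ * s₁ * s₂ * c₃) =
      (c₀ * c₃) * (c₁ * c₂) + ((s₀ * s₃) * (c₁ * c₂) + (c₀ * c₃) * (s₁ * s₂)) := by ring
    rw [e]
    generalize c₀ * c₃ = p at *
    generalize c₁ * c₂ = q at *
    generalize s₀ * s₃ = p' at *
    generalize s₁ * s₂ = q' at *
    nlinarith [mul_nonneg (sub_nonneg.2 (by linarith : p ≤ 1)) (sub_nonneg.2 (by linarith : q ≤ 1))]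
  linarith

/-! ### Upper bounds for the possible thresholds -/

theorem form_eq_form_span {T Z : Tensor n} (hZ : Z ∈ basicSubspace T ∅)
    {a b : (k : Fin d) → EuclideanSpace ℝ (Fin (n k))} (hb : ∀ k, b k ∈ (modeSpan T k)ᗮ) :
    form Z (fun k => a k + b k) = form Z a := by
  have h := (form Z).map_add_univ a b
  rw [Finset.sum_eq_single Finset.univ] at h
  · rw [Finset.piecewise_univ] at h
    exact h
  · intro s _ hs
    obtain ⟨k, hk⟩ : ∃ k, k ∉ s := by
      by_contra! hcon
      exact hs (Finset.eq_univ_iff_forall.2 hcon)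
    exact form_eq_zero_of_mem_basicSubspace_empty hZ _
      ⟨k, by rw [Finset.piecewise_eq_of_notMem _ _ _ hk]; exact hb k⟩
  · simp

theorem form_certificate_le (hd : 0 < d) (hn : ∀ k, 2 ≤ n k) {T Z : Tensor n}
    (hZ : Z ∈ basicSubspace T ∅) (hZ1 : specNorm Z ≤ 1)
    {a b : (k : Fin d) → EuclideanSpace ℝ (Fin (n k))} (hb : ∀ k, b k ∈ (modeSpan T k)ᗮ) :
    |form Z (fun k => a k + b k)| ≤ ∏ k, ‖a k‖ := by
  rw [form_eq_form_span hZ hb, ← one_mul (∏ k, ‖a k‖)]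
  exact abs_form_le_of_specNorm_le hd hn hZ1 a

/-- X = (Z + X) - Z, where the first form is at most 1 and the second at least -∏ c_k. -/
theorem form_le_one_add_prod (hd : 0 < d) (hn : ∀ k, 2 ≤ n k) {T Z X : Tensor n}
    (hZ : Z ∈ basicSubspace T ∅) (hZ1 : specNorm Z ≤ 1) (hS : specNorm (Z + X) ≤ 1)
    {a b : (k : Fin d) → EuclideanSpace ℝ (Fin (n k))} (hb : ∀ k, b k ∈ (modeSpan T k)ᗮ)
    (hx : ∀ k, ‖a k + b k‖ = 1) :
    form X (fun k => a k + b k) ≤ 1 + ∏ k, ‖a k‖ := by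
  have h1 := (form_le_specNorm (Z + X) _ hx).trans hS
  have h2 := (abs_le.1 (form_certificate_le hd hn hZ hZ1 (a := a) hb)).1
  rw [form_add] at h1
  linarith

theorem norm_le_one_of_sq_add_sq {c s : ℝ} (hc : 0 ≤ c) (h : c ^ 2 + s ^ 2 = 1) : c ≤ 1 := by
  nlinarith [sq_nonneg s]

theorem specNorm_le_two (hd : 0 < d) (hn : ∀ k, 2 ≤ n k) {T Z X : Tensor n}
    (hZ : Z ∈ basicSubspace T ∅) (hZ1 : specNorm Z ≤ 1) (hS : specNorm (Z + X) ≤ 1) :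
    specNorm X ≤ 2 := by
  refine specNorm_le zero_le_two fun x hx => ?_
  obtain ⟨a, b, rfl, ha, hb, hab⟩ := exists_split T x hx
  refine (form_le_one_add_prod hd hn hZ hZ1 hS hb hx).trans ?_
  have : ∏ k, ‖a k‖ ≤ 1 := Finset.prod_le_one (fun _ _ => norm_nonneg _)
    fun k _ => norm_le_one_of_sq_add_sq (norm_nonneg _) (hab k)
  linarith

theorem select_two (a b : (k : Fin d) → EuclideanSpace ℝ (Fin (n k))) {p : Fin d → Fin 3}
    (hp : ∀ k, p k = 2) : select a b p = fun k => a k + b k := by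
  funext k; simp [select, hp k]

theorem specNorm_le_of_order_three {n : Fin 3 → ℕ} (hn : ∀ k, 2 ≤ n k) {T Z X : Tensor n}
    (hZ : Z ∈ basicSubspace T ∅) (hZ1 : specNorm Z ≤ 1) (hX : X ∈ sumSubspace (cardAtLeast 3 1) T)
    (hS : specNorm (Z + X) ≤ 1) : specNorm X ≤ 3 / 2 := by
  refine specNorm_le (by norm_num) fun x hx => ?_
  obtain ⟨a, b, rfl, ha, hb, hab⟩ := exists_split T x hx
  have h1 := form_le_one_add_prod (by norm_num) hn hZ hZ1 hS hb hx
  rw [Fin.prod_univ_three] at h1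
  refine le_three_halves (hab 0) (hab 1) (hab 2) h1 ?_
  rw [← select_two a b (p := ![2, 2, 2]) (by decide)]
  have B := abs_form_select_le (by norm_num) hn hS hx
  have V := form_select_eq_zero_of_one hZ (a := a) hb
  -- Splitting stops at the first b: there Z vanishes, so X is bounded by the norm of Z + X. The
  -- pattern without b vanishes because ∅ is not in the family.
  have e₁ := form_select_split X a b ![2, 2, 2] ![0, 2, 2] ![1, 2, 2] 0 (by decide)
  have e₂ := form_select_split X a b ![0, 2, 2] ![0, 0, 2] ![0, 1, 2] 1 (by decide)
  have e₃ := form_select_split X a b ![0, 0, 2] ![0, 0, 0] ![0, 0, 1] 2 (by decide)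
  have z := form_select_eq_zero hX ha hb ![0, 0, 0] (by decide) (by rw [cardAtLeast]; decide)
  have b₁ := (le_abs_self _).trans (B ![1, 2, 2])
  have b₂ := (le_abs_self _).trans (B ![0, 1, 2])
  have b₃ := (le_abs_self _).trans (B ![0, 0, 1])
  rw [form_add, V _ (by decide), zero_add] at b₁ b₂ b₃
  simp [weight, Fin.prod_univ_three] at b₁ b₂ b₃
  linarith

theorem specNorm_le_of_order_three_of_two {n : Fin 3 → ℕ} (hn : ∀ k, 2 ≤ n k)
    {T Z X : Tensor n} (hZ : Z ∈ basicSubspace T ∅) (hZ1 : specNorm Z ≤ 1)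
    (hX : X ∈ sumSubspace (cardAtLeast 3 2) T) (hS : specNorm (Z + X) ≤ 1) :
    specNorm X ≤ (1 + √2) / 2 := by
  refine specNorm_le (by positivity) fun x hx => ?_
  obtain ⟨a, b, rfl, ha, hb, hab⟩ := exists_split T x hx
  have h1 := form_le_one_add_prod (by norm_num) hn hZ hZ1 hS hb hx
  have hp : ∏ k, ‖a k‖ ≤ 1 := Finset.prod_le_one (fun _ _ => norm_nonneg _)
    fun k _ => norm_le_one_of_sq_add_sq (norm_nonneg _) (hab k)
  rw [Fin.prod_univ_three] at h1 hp
  refine le_one_add_sqrt_two_div_two (hab 0) (hab 1) (hab 2) hp h1 ?_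
  rw [← select_two a b (p := ![2, 2, 2]) (by decide)]
  have B := abs_form_select_le (by norm_num) hn hS hx
  have V := form_select_eq_zero_of_one hZ (a := a) hb
  have W := form_select_eq_zero hX ha hb
  have e₁ := form_select_split X a b ![2, 2, 2] ![0, 2, 2] ![1, 2, 2] 0 (by decide)
  have e₂ := form_select_split X a b ![0, 2, 2] ![0, 0, 2] ![0, 1, 2] 1 (by decide)
  have e₃ := form_select_split X a b ![0, 0, 2] ![0, 0, 0] ![0, 0, 1] 2 (by decide)
  -- Patterns with exactly one b vanish on 𝕊_2, so the term c₀ s₁ gains the factor s₂.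
  have e₄ := form_select_split X a b ![0, 1, 2] ![0, 1, 0] ![0, 1, 1] 2 (by decide)
  have z₁ := W ![0, 0, 0] (by decide) (by rw [cardAtLeast]; decide)
  have z₂ := W ![0, 0, 1] (by decide) (by rw [cardAtLeast]; decide)
  have z₃ := W ![0, 1, 0] (by decide) (by rw [cardAtLeast]; decide)
  have b₁ := (le_abs_self _).trans (B ![1, 2, 2])
  have b₂ := (le_abs_self _).trans (B ![0, 1, 1])
  rw [form_add, V _ (by decide), zero_add] at b₁ b₂
  simp [weight, Fin.prod_univ_three] at b₁ b₂
  linarith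

theorem specNorm_le_of_order_four {n : Fin 4 → ℕ} (hn : ∀ k, 2 ≤ n k) {T Z X : Tensor n}
    (hZ : Z ∈ basicSubspace T ∅) (hZ1 : specNorm Z ≤ 1) (hX : X ∈ sumSubspace (cardAtLeast 4 1) T)
    (hS : specNorm (Z + X) ≤ 1) : specNorm X ≤ 8 / 5 := by
  refine specNorm_le (by norm_num) fun x hx => ?_
  obtain ⟨a, b, rfl, ha, hb, hab⟩ := exists_split T x hx
  have h1 := form_le_one_add_prod (by norm_num) hn hZ hZ1 hS hb hx
  rw [Fin.prod_univ_four] at h1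
  refine le_eight_fifths (hab 0) (hab 1) (hab 2) (hab 3) h1 ?_
  rw [← select_two a b (p := ![2, 2, 2, 2]) (by decide)]
  have B := abs_form_select_le (by norm_num) hn hS hx
  have V := form_select_eq_zero_of_one hZ (a := a) hb
  have e₁ := form_select_split X a b ![2, 2, 2, 2] ![0, 2, 2, 2] ![1, 2, 2, 2] 0 (by decide)
  have e₂ := form_select_split X a b ![0, 2, 2, 2] ![0, 0, 2, 2] ![0, 1, 2, 2] 1 (by decide)
  have e₃ := form_select_split X a b ![0, 0, 2, 2] ![0, 0, 0, 2] ![0, 0, 1, 2] 2 (by decide)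
  have e₄ := form_select_split X a b ![0, 0, 0, 2] ![0, 0, 0, 0] ![0, 0, 0, 1] 3 (by decide)
  have z := form_select_eq_zero hX ha hb ![0, 0, 0, 0] (by decide) (by rw [cardAtLeast]; decide)
  have b₁ := (le_abs_self _).trans (B ![1, 2, 2, 2])
  have b₂ := (le_abs_self _).trans (B ![0, 1, 2, 2])
  have b₃ := (le_abs_self _).trans (B ![0, 0, 1, 2])
  have b₄ := (le_abs_self _).trans (B ![0, 0, 0, 1])
  rw [form_add, V _ (by decide), zero_add] at b₁ b₂ b₃ b₄
  simp [weight, Fin.prod_univ_four] at b₁ b₂ b₃ b₄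
  linarith

theorem specNorm_le_of_order_four_of_two {n : Fin 4 → ℕ} (hn : ∀ k, 2 ≤ n k)
    {T Z X : Tensor n} (hZ : Z ∈ basicSubspace T ∅) (hZ1 : specNorm Z ≤ 1)
    (hX : X ∈ sumSubspace (cardAtLeast 4 2) T) (hS : specNorm (Z + X) ≤ 1) :
    specNorm X ≤ (1 + √3) / 2 := by
  refine specNorm_le (by positivity) fun x hx => ?_
  obtain ⟨a, b, rfl, ha, hb, hab⟩ := exists_split T x hx
  have h1 := form_le_one_add_prod (by norm_num) hn hZ hZ1 hS hb hx
  have hp : ∏ k, ‖a k‖ ≤ 1 := Finset.prod_le_one (fun _ _ => norm_nonneg _)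
    fun k _ => norm_le_one_of_sq_add_sq (norm_nonneg _) (hab k)
  rw [Fin.prod_univ_four] at h1 hp
  refine le_one_add_sqrt_three_div_two (hab 0) (hab 1) (hab 2) (hab 3) hp h1 ?_
  rw [← select_two a b (p := ![2, 2, 2, 2]) (by decide)]
  have B := abs_form_select_le (by norm_num) hn hS hx
  have V := form_select_eq_zero_of_one hZ (a := a) hb
  have W := form_select_eq_zero hX ha hb
  have e₁ := form_select_split X a b ![2, 2, 2, 2] ![0, 2, 2, 2] ![1, 2, 2, 2] 0 (by decide)
  have e₂ := form_select_split X a b ![0, 2, 2, 2] ![0, 0, 2, 2] ![0, 1, 2, 2] 1 (by decide)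
  have e₃ := form_select_split X a b ![0, 0, 2, 2] ![0, 0, 0, 2] ![0, 0, 1, 2] 2 (by decide)
  have e₄ := form_select_split X a b ![0, 0, 0, 2] ![0, 0, 0, 0] ![0, 0, 0, 1] 3 (by decide)
  have e₅ := form_select_split X a b ![0, 0, 1, 2] ![0, 0, 1, 0] ![0, 0, 1, 1] 3 (by decide)
  have z₁ := W ![0, 0, 0, 0] (by decide) (by rw [cardAtLeast]; decide)
  have z₂ := W ![0, 0, 0, 1] (by decide) (by rw [cardAtLeast]; decide)
  have z₃ := W ![0, 0, 1, 0] (by decide) (by rw [cardAtLeast]; decide)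
  have b₁ := (le_abs_self _).trans (B ![1, 2, 2, 2])
  have b₂ := (le_abs_self _).trans (B ![0, 1, 2, 2])
  have b₃ := (le_abs_self _).trans (B ![0, 0, 1, 1])
  rw [form_add, V _ (by decide), zero_add] at b₁ b₂ b₃
  simp [weight, Fin.prod_univ_four] at b₁ b₂ b₃
  linarith

/-! ### Lower bounds for the guaranteed thresholds -/

theorem specNorm_add_le_one_of_order_three {n : Fin 3 → ℕ} (hn : ∀ k, 2 ≤ n k)
    {T Z X : Tensor n} (hZ : Z ∈ basicSubspace T ∅) (hZ1 : specNorm Z ≤ 1)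
    (hX : X ∈ sumSubspace (cardAtLeast 3 2) T) (hX1 : specNorm X ≤ 1 / 2) :
    specNorm (Z + X) ≤ 1 := by
  refine specNorm_le zero_le_one fun x hx => ?_
  obtain ⟨a, b, rfl, ha, hb, hab⟩ := exists_split T x hx
  have h1 := (le_abs_self _).trans (form_certificate_le (by norm_num) hn hZ hZ1 (a := a) hb)
  rw [Fin.prod_univ_three] at h1
  have hmain := add_half_le_one (hab 0) (hab 1) (hab 2) (norm_nonneg _) (norm_nonneg _)
    (norm_nonneg _) (norm_nonneg _)
  rw [form_add]
  rw [← select_two a b (p := ![2, 2, 2]) (by decide)] at h1 ⊢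
  have B := abs_form_select_le (by norm_num) hn hX1 hx
  have W := form_select_eq_zero hX ha hb
  have e₁ := form_select_split X a b ![2, 2, 2] ![0, 2, 2] ![1, 2, 2] 0 (by decide)
  have e₂ := form_select_split X a b ![0, 2, 2] ![0, 0, 2] ![0, 1, 2] 1 (by decide)
  have e₃ := form_select_split X a b ![0, 0, 2] ![0, 0, 0] ![0, 0, 1] 2 (by decide)
  have e₄ := form_select_split X a b ![0, 1, 2] ![0, 1, 0] ![0, 1, 1] 2 (by decide)
  have e₅ := form_select_split X a b ![1, 2, 2] ![1, 0, 2] ![1, 1, 2] 1 (by decide)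
  have e₆ := form_select_split X a b ![1, 0, 2] ![1, 0, 0] ![1, 0, 1] 2 (by decide)
  have z₁ := W ![0, 0, 0] (by decide) (by rw [cardAtLeast]; decide)
  have z₂ := W ![0, 0, 1] (by decide) (by rw [cardAtLeast]; decide)
  have z₃ := W ![0, 1, 0] (by decide) (by rw [cardAtLeast]; decide)
  have z₄ := W ![1, 0, 0] (by decide) (by rw [cardAtLeast]; decide)
  have b₁ := (le_abs_self _).trans (B ![1, 1, 2])
  have b₂ := (le_abs_self _).trans (B ![1, 0, 1])
  have b₃ := (le_abs_self _).trans (B ![0, 1, 1])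
  simp [weight, Fin.prod_univ_three] at b₁ b₂ b₃
  linarith

theorem specNorm_add_le_one_of_order_four {n : Fin 4 → ℕ} (hn : ∀ k, 2 ≤ n k)
    {T Z X : Tensor n} (hZ : Z ∈ basicSubspace T ∅) (hZ1 : specNorm Z ≤ 1)
    (hX : X ∈ sumSubspace (cardAtLeast 4 2) T) (hX1 : specNorm X ≤ 1 / 3) :
    specNorm (Z + X) ≤ 1 := by
  refine specNorm_le zero_le_one fun x hx => ?_
  obtain ⟨a, b, rfl, ha, hb, hab⟩ := exists_split T x hx
  have h1 := (le_abs_self _).trans (form_certificate_le (by norm_num) hn hZ hZ1 (a := a) hb)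
  rw [Fin.prod_univ_four] at h1
  have hmain := add_third_le_one (hab 0) (hab 1) (hab 2) (hab 3) (norm_nonneg _) (norm_nonneg _)
    (norm_nonneg _) (norm_nonneg _) (norm_nonneg _) (norm_nonneg _) (norm_nonneg _)
    (norm_nonneg _)
  rw [form_add]
  rw [← select_two a b (p := ![2, 2, 2, 2]) (by decide)] at h1 ⊢
  have B := abs_form_select_le (by norm_num) hn hX1 hx
  have W := form_select_eq_zero hX ha hb
  have e₁ := form_select_split X a b ![2, 2, 2, 2] ![0, 2, 2, 2] ![1, 2, 2, 2] 0 (by decide)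
  have e₂ := form_select_split X a b ![1, 2, 2, 2] ![1, 0, 2, 2] ![1, 1, 2, 2] 1 (by decide)
  have e₃ := form_select_split X a b ![1, 0, 2, 2] ![1, 0, 0, 2] ![1, 0, 1, 2] 2 (by decide)
  have e₄ := form_select_split X a b ![1, 0, 0, 2] ![1, 0, 0, 0] ![1, 0, 0, 1] 3 (by decide)
  have e₅ := form_select_split X a b ![0, 2, 2, 2] ![0, 0, 2, 2] ![0, 1, 2, 2] 1 (by decide)
  -- Mode 3 is split before mode 2 here, which yields the terms c₀s₁s₃ and c₀s₁s₂c₃ of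
  -- `add_third_le_one`.
  have e₆ := form_select_split X a b ![0, 1, 2, 2] ![0, 1, 2, 0] ![0, 1, 2, 1] 3 (by decide)
  have e₇ := form_select_split X a b ![0, 1, 2, 0] ![0, 1, 0, 0] ![0, 1, 1, 0] 2 (by decide)
  have e₈ := form_select_split X a b ![0, 0, 2, 2] ![0, 0, 0, 2] ![0, 0, 1, 2] 2 (by decide)
  have e₉ := form_select_split X a b ![0, 0, 0, 2] ![0, 0, 0, 0] ![0, 0, 0, 1] 3 (by decide)
  have e₁₀ := form_select_split X a b ![0, 0, 1, 2] ![0, 0, 1, 0] ![0, 0, 1, 1] 3 (by decide)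
  have z₁ := W ![0, 0, 0, 0] (by decide) (by rw [cardAtLeast]; decide)
  have z₂ := W ![1, 0, 0, 0] (by decide) (by rw [cardAtLeast]; decide)
  have z₃ := W ![0, 1, 0, 0] (by decide) (by rw [cardAtLeast]; decide)
  have z₄ := W ![0, 0, 1, 0] (by decide) (by rw [cardAtLeast]; decide)
  have z₅ := W ![0, 0, 0, 1] (by decide) (by rw [cardAtLeast]; decide)
  have b₁ := (le_abs_self _).trans (B ![1, 1, 2, 2])
  have b₂ := (le_abs_self _).trans (B ![1, 0, 1, 2])
  have b₃ := (le_abs_self _).trans (B ![0, 1, 2, 1])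
  have b₄ := (le_abs_self _).trans (B ![1, 0, 0, 1])
  have b₅ := (le_abs_self _).trans (B ![0, 1, 1, 0])
  have b₆ := (le_abs_self _).trans (B ![0, 0, 1, 1])
  simp [weight, Fin.prod_univ_four] at b₁ b₂ b₃ b₄ b₅ b₆
  linarith

theorem form_eq_zero_of_card_le_one {T X : Tensor n} (hX : X ∈ sumSubspace (cardAtLeast d 2) T)
    (x : (k : Fin d) → EuclideanSpace ℝ (Fin (n k))) (i : Fin d)
    (h : ∀ k, k ≠ i → x k ∈ modeSpan T k) : form X x = 0 := by
  refine form_eq_zero_of_mem_sumSubspace hX x fun I hI => ?_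
  rw [cardAtLeast, Finset.mem_filter] at hI
  obtain ⟨k, hk, hki⟩ := Finset.exists_mem_ne hI.2 i
  exact ⟨k, Or.inl ⟨hk, h k hki⟩⟩

/-- With b_i fixed, the modes of t are split one at a time. Each b_j that appears costs at most τ
s_i s_j, and the last term has a single b and vanishes. -/
theorem abs_form_update_piecewise_le (hd : 0 < d) (hn : ∀ k, 2 ≤ n k) {T X : Tensor n} {τ : ℝ}
    (hτ : 0 ≤ τ) (hX : X ∈ sumSubspace (cardAtLeast d 2) T) (hXτ : specNorm X ≤ τ)
    {a b : (k : Fin d) → EuclideanSpace ℝ (Fin (n k))} (hx : ∀ k, ‖a k + b k‖ = 1)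
    (ha : ∀ k, a k ∈ modeSpan T k) (ha1 : ∀ k, ‖a k‖ ≤ 1) (hb1 : ∀ k, ‖b k‖ ≤ 1)
    {t : Finset (Fin d)} {i : Fin d} (hi : i ∉ t) :
    |form X (Function.update (t.piecewise (fun k => a k + b k) a) i (b i))| ≤
      τ * (‖b i‖ * ∑ j ∈ t, ‖b j‖) := by
  induction t using Finset.induction_on with
  | empty =>
    rw [form_eq_zero_of_card_le_one hX _ i]
    · simp
    · intro k hk
      simpa [hk] using ha k
  | insert j t hj ih =>
    rw [Finset.mem_insert, not_or] at hi
    have hs : ∀ u : EuclideanSpace ℝ (Fin (n j)),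
        Function.update (Function.update ((insert j t).piecewise (fun k => a k + b k) a) i (b i))
          j u = Function.update (Function.update (t.piecewise (fun k => a k + b k) a) i (b i))
          j u := by
      intro u
      funext k
      by_cases hkj : k = j
      · subst hkj; simp
      · by_cases hki : k = i
        · subst hki; simp [hkj]
        · simp [hkj, hki, Finset.piecewise]
    have haj : Function.update (Function.update (t.piecewise (fun k => a k + b k) a) i (b i))
        j (a j) = Function.update (t.piecewise (fun k => a k + b k) a) i (b i) := by
      rw [Function.update_eq_self_iff, Function.update_of_ne (Ne.symm hi.1),
        Finset.piecewise_eq_of_notMem _ _ _ hj]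
    rw [form_split X _ j (u := a j) (v := b j) (by simp [Ne.symm hi.1]), hs, hs, haj,
      Finset.sum_insert hj]
    refine (abs_add_le _ _).trans ?_
    have h2 : |form X (Function.update (Function.update (t.piecewise (fun k => a k + b k) a)
        i (b i)) j (b j))| ≤ τ * (‖b i‖ * ‖b j‖) := by
      refine (abs_form_le_of_specNorm_le hd hn hXτ _).trans (mul_le_mul_of_nonneg_left ?_ hτ)
      refine (prod_le_mul_of_ne (fun _ => norm_nonneg _)
        (norm_update_le_one (norm_update_le_one (fun k => ?_) (hb1 i)) (hb1 j)) hi.1).trans ?_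
      · by_cases hk : k ∈ t
        · simpa [hk] using (hx k).le
        · simpa [hk] using ha1 k
      · simp [hi.1]
    linarith [ih hi.2]

/-- The right-hand side is τ ∑ s_i s_j over the pairs i < j in t. Adding a mode i to t adds the term
with b_i, estimated by `abs_form_update_piecewise_le`. -/
theorem abs_form_piecewise_le (hd : 0 < d) (hn : ∀ k, 2 ≤ n k) {T X : Tensor n} {τ : ℝ}
    (hτ : 0 ≤ τ) (hX : X ∈ sumSubspace (cardAtLeast d 2) T) (hXτ : specNorm X ≤ τ)
    {a b : (k : Fin d) → EuclideanSpace ℝ (Fin (n k))} (hx : ∀ k, ‖a k + b k‖ = 1)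
    (ha : ∀ k, a k ∈ modeSpan T k) (ha1 : ∀ k, ‖a k‖ ≤ 1) (hb1 : ∀ k, ‖b k‖ ≤ 1)
    (t : Finset (Fin d)) :
    |form X (t.piecewise (fun k => a k + b k) a)| ≤
      τ * (1 / 2 * ((∑ j ∈ t, ‖b j‖) ^ 2 - ∑ j ∈ t, ‖b j‖ ^ 2)) := by
  induction t using Finset.induction_on with
  | empty =>
    rw [form_eq_zero_of_card_le_one hX _ ⟨0, hd⟩]
    · simp
    · intro k _
      simpa using ha k
  | insert i t hi ih =>
    have haj : Function.update (t.piecewise (fun k => a k + b k) a) i (a i) =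
        t.piecewise (fun k => a k + b k) a := by
      rw [Function.update_eq_self_iff, Finset.piecewise_eq_of_notMem _ _ _ hi]
    rw [Finset.piecewise_insert, MultilinearMap.map_update_add, haj, Finset.sum_insert hi,
      Finset.sum_insert hi]
    refine (abs_add_le _ _).trans ?_
    have h2 := abs_form_update_piecewise_le hd hn hτ hX hXτ hx ha ha1 hb1 hi
    have e : τ * (1 / 2 * ((‖b i‖ + ∑ j ∈ t, ‖b j‖) ^ 2 - (‖b i‖ ^ 2 + ∑ j ∈ t, ‖b j‖ ^ 2))) =
        τ * (1 / 2 * ((∑ j ∈ t, ‖b j‖) ^ 2 - ∑ j ∈ t, ‖b j‖ ^ 2)) +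
        τ * (‖b i‖ * ∑ j ∈ t, ‖b j‖) := by ring
    linarith

/-- ∏ c_k ≤ c_i c_j for each of the d(d - 1) ordered pairs i ≠ j; these are summed. -/
theorem prod_mul_le_sq_sum_sub {c : Fin d → ℝ} (h0 : ∀ k, 0 ≤ c k) (h1 : ∀ k, c k ≤ 1) :
    ((d : ℝ) * (d - 1)) * ∏ k, c k ≤ (∑ k, c k) ^ 2 - ∑ k, c k ^ 2 := by
  have e : ∀ g : Fin d → Fin d → ℝ,
      ∑ i, ∑ j, (if i = j then 0 else g i j) = ∑ i, ∑ j, g i j - ∑ i, g i i := by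
    intro g
    rw [← Finset.sum_sub_distrib]
    refine Finset.sum_congr rfl fun i _ => ?_
    have : ∀ j, (if i = j then 0 else g i j) = g i j - if i = j then g i j else 0 := by
      intro j; split_ifs <;> simp
    simp [this]
  have hle : ∑ i : Fin d, ∑ j : Fin d, (if i = j then 0 else ∏ k, c k) ≤
      ∑ i, ∑ j, (if i = j then 0 else c i * c j) := by
    refine Finset.sum_le_sum fun i _ => Finset.sum_le_sum fun j _ => ?_
    split_ifs with h
    · exact le_rfl
    · exact prod_le_mul_of_ne h0 h1 h
  rw [e, e] at hle
  simp only [Finset.sum_const, Finset.card_univ, Fintype.card_fin, nsmul_eq_mul] at hle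
  rw [← Finset.sum_mul_sum, ← pow_two] at hle
  simp only [← pow_two] at hle
  linarith

/-- After multiplication by d(d - 1), the product is replaced by the sum of c_i c_j over i ≠ j. By
Cauchy-Schwarz (∑ c)² + (∑ s)² ≤ d², and subtracting ∑ (c_k² + s_k²) = d leaves d(d - 1). -/
theorem prod_add_pair_sum_le_one (hd : 2 ≤ d) {c s : Fin d → ℝ} (hc : ∀ k, 0 ≤ c k)
    (h : ∀ k, c k ^ 2 + s k ^ 2 = 1) :
    ∏ k, c k + 2 / ((d : ℝ) * (d - 1)) * (1 / 2 * ((∑ j, s j) ^ 2 - ∑ j, s j ^ 2)) ≤ 1 := by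
  have hd' : (2 : ℝ) ≤ d := by exact_mod_cast hd
  have hD : 0 < (d : ℝ) * (d - 1) := mul_pos (by linarith) (by linarith)
  have h1 := prod_mul_le_sq_sum_sub hc fun k => norm_le_one_of_sq_add_sq (hc k) (h k)
  have h2 := sq_sum_le_card_mul_sum_sq (s := Finset.univ) (f := c)
  have h3 := sq_sum_le_card_mul_sum_sq (s := Finset.univ) (f := s)
  have h4 : ∑ k, c k ^ 2 + ∑ k, s k ^ 2 = d := by
    rw [← Finset.sum_add_distrib]
    simp [h]
  rw [Finset.card_univ, Fintype.card_fin] at h2 h3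
  have h5 : (∑ k, c k) ^ 2 + (∑ k, s k) ^ 2 ≤ d * d := by
    calc _ ≤ (d : ℝ) * ∑ k, c k ^ 2 + d * ∑ k, s k ^ 2 := add_le_add h2 h3
      _ = _ := by rw [← mul_add, h4]
  have e : ∏ k, c k + 2 / ((d : ℝ) * (d - 1)) * (1 / 2 * ((∑ j, s j) ^ 2 - ∑ j, s j ^ 2)) =
      (((d : ℝ) * (d - 1)) * ∏ k, c k + ((∑ j, s j) ^ 2 - ∑ j, s j ^ 2)) /
        ((d : ℝ) * (d - 1)) := by
    have : (d : ℝ) ≠ 0 := by linarith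
    have : (d : ℝ) - 1 ≠ 0 := by linarith
    field_simp
  rw [e, div_le_one hD]
  linarith

theorem specNorm_add_le_one_of_pairs (hd : 2 ≤ d) (hn : ∀ k, 2 ≤ n k)
    {T Z X : Tensor n} (hZ : Z ∈ basicSubspace T ∅) (hZ1 : specNorm Z ≤ 1)
    (hX : X ∈ sumSubspace (cardAtLeast d 2) T)
    (hX1 : specNorm X ≤ 2 / ((d : ℝ) * ((d : ℝ) - 1))) : specNorm (Z + X) ≤ 1 := by
  refine specNorm_le zero_le_one fun x hx => ?_
  obtain ⟨a, b, rfl, ha, hb, hab⟩ := exists_split T x hx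
  have h1 := (le_abs_self _).trans (form_certificate_le (by omega) hn hZ hZ1 (a := a) hb)
  have ha1 : ∀ k, ‖a k‖ ≤ 1 := fun k => norm_le_one_of_sq_add_sq (norm_nonneg _) (hab k)
  have hb1 : ∀ k, ‖b k‖ ≤ 1 := fun k =>
    norm_le_one_of_sq_add_sq (norm_nonneg _) ((add_comm _ _).trans (hab k))
  have h2 := (le_abs_self _).trans (abs_form_piecewise_le (by omega) hn
    ((specNorm_nonneg (by omega) hn X).trans hX1) hX hX1 hx ha ha1 hb1 Finset.univ)
  rw [Finset.piecewise_univ] at h2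
  have h3 := prod_add_pair_sum_le_one hd (c := fun k => ‖a k‖) (s := fun k => ‖b k‖)
    (fun _ => norm_nonneg _) hab
  rw [form_add]
  linarith

/-! ### Certificates -/

/-- Duality of the two norms: the decomposition of T into r unit rank-one terms gives ‖T‖_* ≤ r, and
pairing any decomposition with Z, where ‖Z‖_σ ≤ 1 and ⟨Z, T⟩ = r, gives ‖T‖_* ≥ r. The same pairing
forces ‖Z‖_σ = 1. -/
theorem mem_certificates (hd : 0 < d) {r : ℕ} (hr : 0 < r) {T Z : Tensor n}
    (hZ : Z ∈ basicSubspace T ∅) (hZ1 : specNorm Z ≤ 1)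
    (y : Fin r → (k : Fin d) → EuclideanSpace ℝ (Fin (n k))) (hy : ∀ i k, ‖y i k‖ = 1)
    (hT : T = ∑ i, outer (y i)) (hZT : inner ℝ Z T = (r : ℝ)) : Z ∈ certificates T := by
  have hr' : (0 : ℝ) < r := by exact_mod_cast hr
  have hT0 : T ≠ 0 := by
    intro h
    rw [h, inner_zero_right] at hZT
    exact hr'.ne hZT
  refine Or.inr ⟨hT0, hZ, ?_, le_antisymm hZ1 ?_⟩
  · have hmem : (r : ℝ) ∈ {s : ℝ | ∃ (r : ℕ) (c : Fin r → ℝ)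
        (x : Fin r → (k : Fin d) → EuclideanSpace ℝ (Fin (n k))),
        (∀ i k, ‖x i k‖ = 1) ∧ T = ∑ i, c i • outer (x i) ∧ s = ∑ i, |c i|} :=
      ⟨r, fun _ => 1, y, hy, by simpa using hT, by simp⟩
    rw [hZT]
    refine le_antisymm (le_csInf ⟨_, hmem⟩ ?_) (csInf_le ⟨0, ?_⟩ hmem)
    · rintro _ ⟨m, c, x, hx, hTx, rfl⟩
      rw [← hZT, hTx, inner_sum]
      refine Finset.sum_le_sum fun i _ => ?_
      rw [real_inner_smul_right, inner_outer]
      refine (le_abs_self _).trans ?_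
      rw [abs_mul]
      exact mul_le_of_le_one_right (abs_nonneg _)
        ((abs_form_le_specNorm hd Z (x i) (hx i)).trans hZ1)
    · rintro _ ⟨m, c, x, hx, hTx, rfl⟩
      exact Finset.sum_nonneg fun _ _ => abs_nonneg _
  · have h : inner ℝ Z T ≤ r * specNorm Z := by
      rw [hT, inner_sum]
      refine (Finset.sum_le_sum fun i _ =>
        (inner_outer Z (y i)).le.trans (form_le_specNorm Z (y i) (hy i))).trans ?_
      simp
    rw [hZT] at h
    exact le_of_mul_le_mul_left (by simpa using h) hr'

/-! ### Tensors supported on `2 × ⋯ × 2` corners -/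

/-- The multi-index with entry `1` on `K` and entry `0` elsewhere. -/
def corner (hn : ∀ k, 2 ≤ n k) (K : Finset (Fin d)) (k : Fin d) : Fin (n k) :=
  if k ∈ K then ⟨1, hn k⟩ else ⟨0, lt_of_lt_of_le two_pos (hn k)⟩

theorem corner_eq_iff (hn : ∀ k, 2 ≤ n k) (K K' : Finset (Fin d)) (k : Fin d) :
    corner hn K k = corner hn K' k ↔ (k ∈ K ↔ k ∈ K') := by
  unfold corner
  by_cases h : k ∈ K <;> by_cases h' : k ∈ K' <;> simp [h, h']

theorem corner_injective (hn : ∀ k, 2 ≤ n k) : Function.Injective (corner hn) :=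
  fun K K' h => Finset.ext fun k => (corner_eq_iff hn K K' k).1 (congrFun h k)

/-- The standard basis vectors along the multi-index `corner hn K`. -/
def cornerVec (hn : ∀ k, 2 ≤ n k) (K : Finset (Fin d)) (k : Fin d) :
    EuclideanSpace ℝ (Fin (n k)) :=
  EuclideanSpace.single (corner hn K k) 1

/-- The tensor with a single entry `1`, at the multi-index `corner hn K`. -/
def cornerTensor (hn : ∀ k, 2 ≤ n k) (K : Finset (Fin d)) : Tensor n :=
  EuclideanSpace.single (corner hn K) 1

theorem cornerVec_norm (hn : ∀ k, 2 ≤ n k) (K : Finset (Fin d)) (k : Fin d) :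
    ‖cornerVec hn K k‖ = 1 := by simp [cornerVec]

theorem cornerTensor_apply (hn : ∀ k, 2 ≤ n k) (K : Finset (Fin d))
    (i : (k : Fin d) → Fin (n k)) : cornerTensor hn K i = if i = corner hn K then 1 else 0 := by
  simp [cornerTensor]

theorem cornerTensor_eq_outer (hn : ∀ k, 2 ≤ n k) (K : Finset (Fin d)) :
    cornerTensor hn K = outer (cornerVec hn K) := by
  ext i
  rw [cornerTensor_apply]
  by_cases h : i = corner hn K
  · simp [h, outer, cornerVec]
  · rw [if_neg h]
    obtain ⟨k, hk⟩ := Function.ne_iff.1 h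
    exact (Finset.prod_eq_zero (Finset.mem_univ k) (by simp [cornerVec, hk])).symm

theorem form_cornerTensor (hn : ∀ k, 2 ≤ n k) (K : Finset (Fin d))
    (x : (k : Fin d) → EuclideanSpace ℝ (Fin (n k))) :
    form (cornerTensor hn K) x = ∏ k, x k (corner hn K k) := by
  rw [form_apply, Finset.sum_eq_single (corner hn K)]
  · simp [cornerTensor_apply]
  · intro i _ hi
    simp [cornerTensor_apply, hi]
  · simp

theorem form_cornerTensor_cornerVec (hn : ∀ k, 2 ≤ n k) (K K' : Finset (Fin d)) :
    form (cornerTensor hn K) (cornerVec hn K') = if K = K' then 1 else 0 := by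
  rw [← inner_outer, ← cornerTensor_eq_outer, cornerTensor, EuclideanSpace.inner_single_left,
    cornerTensor_apply]
  simp [(corner_injective hn).eq_iff]

theorem inner_cornerTensor (hn : ∀ k, 2 ≤ n k) (K K' : Finset (Fin d)) :
    inner ℝ (cornerTensor hn K) (cornerTensor hn K') = if K = K' then (1 : ℝ) else 0 := by
  rw [cornerTensor_eq_outer hn K', inner_outer, form_cornerTensor_cornerVec]

theorem cornerTensor_mem_basicSubspace (hn : ∀ k, 2 ≤ n k) {T : Tensor n}
    {K I : Finset (Fin d)} (h : ∀ k ∈ I, cornerVec hn K k ∈ (modeSpan T k)ᗮ)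
    (h' : ∀ k ∉ I, cornerVec hn K k ∈ modeSpan T k) :
    cornerTensor hn K ∈ basicSubspace T I := by
  refine Submodule.subset_span ⟨cornerVec hn K, fun k => ?_, cornerTensor_eq_outer hn K⟩
  by_cases hk : k ∈ I
  · simpa [hk] using h k hk
  · simpa [hk] using h' k hk

theorem cornerVec_mem_modeSpan (hn : ∀ k, 2 ≤ n k) {T : Tensor n} {K : Finset (Fin d)}
    {k : Fin d} (h : ∀ j, T (Function.update (corner hn K) k j) =
      if j = corner hn K k then 1 else 0) : cornerVec hn K k ∈ modeSpan T k := by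
  refine Submodule.subset_span ⟨corner hn K, ?_⟩
  ext j
  simp [fiber, cornerVec, h]

theorem cornerVec_mem_orthogonal (hn : ∀ k, 2 ≤ n k) {T : Tensor n} {K : Finset (Fin d)}
    {k : Fin d} (h : ∀ i, T (Function.update i k (corner hn K k)) = 0) :
    cornerVec hn K k ∈ (modeSpan T k)ᗮ := by
  have hle : modeSpan T k ≤ (Submodule.span ℝ {cornerVec hn K k})ᗮ := by
    refine Submodule.span_le.2 ?_
    rintro _ ⟨i, rfl⟩
    rw [SetLike.mem_coe, Submodule.mem_orthogonal_singleton_iff_inner_right, cornerVec,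
      EuclideanSpace.inner_single_left]
    simp [fiber, h]
  exact Submodule.orthogonal_le hle (Submodule.le_orthogonal_orthogonal _
    (Submodule.mem_span_singleton_self _))

theorem specNorm_cornerTensor_le (hn : ∀ k, 2 ≤ n k) (K : Finset (Fin d)) :
    specNorm (cornerTensor hn K) ≤ 1 := by
  refine specNorm_le zero_le_one fun x hx => ?_
  rw [form_cornerTensor]
  refine (le_abs_self _).trans ?_
  rw [Finset.abs_prod]
  refine Finset.prod_le_one (fun _ _ => abs_nonneg _) fun k _ => ?_
  have := PiLp.norm_apply_le (x k) (corner hn K k)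
  rwa [hx k, Real.norm_eq_abs] at this

/-! ### The rank-one tensor `e₀ ⊗ ⋯ ⊗ e₀` -/

theorem cornerVec_mem_modeSpan_base (hn : ∀ k, 2 ≤ n k) {K : Finset (Fin d)} {k : Fin d}
    (hk : k ∉ K) : cornerVec hn K k ∈ modeSpan (cornerTensor hn ∅) k := by
  have h : cornerVec hn K k = cornerVec hn ∅ k := by simp [cornerVec, corner, hk]
  rw [h]
  refine cornerVec_mem_modeSpan hn fun j => ?_
  simp [cornerTensor_apply]

theorem cornerVec_mem_orthogonal_base (hn : ∀ k, 2 ≤ n k) {K : Finset (Fin d)} {k : Fin d}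
    (hk : k ∈ K) : cornerVec hn K k ∈ (modeSpan (cornerTensor hn ∅) k)ᗮ := by
  refine cornerVec_mem_orthogonal hn fun i => ?_
  rw [cornerTensor_apply, if_neg]
  intro h
  have := congrFun h k
  rw [Function.update_self, corner_eq_iff] at this
  simp [hk] at this

theorem cornerTensor_mem_base (hn : ∀ k, 2 ≤ n k) (K : Finset (Fin d)) :
    cornerTensor hn K ∈ basicSubspace (cornerTensor hn ∅) K :=
  cornerTensor_mem_basicSubspace hn (fun _ h => cornerVec_mem_orthogonal_base hn h)
    fun _ h => cornerVec_mem_modeSpan_base hn h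

theorem cornerTensor_mem_sumSubspace (hn : ∀ k, 2 ≤ n k) {K : Finset (Fin d)}
    {J : Finset (Finset (Fin d))} (h : K ∈ J) :
    cornerTensor hn K ∈ sumSubspace J (cornerTensor hn ∅) :=
  le_iSup₂_of_le (f := fun I (_ : I ∈ J) => basicSubspace (cornerTensor hn ∅) I) K h le_rfl
    (cornerTensor_mem_base hn K)

theorem base_mem_certificates (hd : 0 < d) (hn : ∀ k, 2 ≤ n k) :
    cornerTensor hn ∅ ∈ certificates (cornerTensor hn ∅) := by
  refine mem_certificates hd one_pos (cornerTensor_mem_base hn ∅) (specNorm_cornerTensor_le hn ∅)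
    (fun _ => cornerVec hn ∅) (fun _ => cornerVec_norm hn ∅) ?_ ?_
  · simp [cornerTensor_eq_outer]
  · rw [inner_cornerTensor]
    simp

/-! ### Embedding tensors of small order -/

/-- The factor contributed by the modes outside the range of `ι`. -/
def restFactor (hn : ∀ k, 2 ≤ n k) {m : ℕ} (ι : Fin m ↪ Fin d)
    (x : (k : Fin d) → EuclideanSpace ℝ (Fin (n k))) : ℝ :=
  ∏ k ∈ (Finset.univ.map ι)ᶜ, x k (corner hn ∅ k)

/-- The `0`-th coordinate in the mode `k`. -/
def lo (hn : ∀ k, 2 ≤ n k) (x : (k : Fin d) → EuclideanSpace ℝ (Fin (n k))) (k : Fin d) : ℝ :=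
  x k (corner hn ∅ k)

/-- The first coordinate in the mode `k`. -/
def hi (hn : ∀ k, 2 ≤ n k) (x : (k : Fin d) → EuclideanSpace ℝ (Fin (n k))) (k : Fin d) : ℝ :=
  x k (corner hn Finset.univ k)

theorem form_cornerTensor_map (hn : ∀ k, 2 ≤ n k) {m : ℕ} (ι : Fin m ↪ Fin d)
    (K : Finset (Fin m)) (x : (k : Fin d) → EuclideanSpace ℝ (Fin (n k))) :
    form (cornerTensor hn (K.map ι)) x =
      (∏ i, if i ∈ K then hi hn x (ι i) else lo hn x (ι i)) * restFactor hn ι x := by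
  rw [form_cornerTensor, ← Finset.prod_mul_prod_compl (Finset.univ.map ι), Finset.prod_map]
  congr 1
  · refine Finset.prod_congr rfl fun i _ => ?_
    by_cases h : i ∈ K <;> simp [h, hi, lo, corner]
  · refine Finset.prod_congr rfl fun k hk => ?_
    have h : k ∉ K.map ι := by
      intro hkK
      rw [Finset.mem_compl] at hk
      exact hk (Finset.map_subset_map.2 (Finset.subset_univ K) hkK)
    simp [corner, h]

theorem lo_sq_add_hi_sq_le (hn : ∀ k, 2 ≤ n k) {x : (k : Fin d) → EuclideanSpace ℝ (Fin (n k))}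
    (hx : ∀ k, ‖x k‖ = 1) (k : Fin d) : lo hn x k ^ 2 + hi hn x k ^ 2 ≤ 1 := by
  have h := EuclideanSpace.norm_sq_eq (x k)
  rw [hx k, one_pow] at h
  rw [h]
  have hne : corner hn ∅ k ≠ corner hn Finset.univ k := by simp [corner_eq_iff]
  rw [lo, hi, ← Finset.sum_pair (f := fun i => x k i ^ 2) hne]
  simp only [Real.norm_eq_abs, sq_abs]
  exact Finset.sum_le_sum_of_subset_of_nonneg (Finset.subset_univ _) fun _ _ _ => sq_nonneg _

theorem abs_restFactor_le (hn : ∀ k, 2 ≤ n k) {m : ℕ} (ι : Fin m ↪ Fin d)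
    {x : (k : Fin d) → EuclideanSpace ℝ (Fin (n k))} (hx : ∀ k, ‖x k‖ = 1) :
    |restFactor hn ι x| ≤ 1 := by
  rw [restFactor, Finset.abs_prod]
  refine Finset.prod_le_one (fun _ _ => abs_nonneg _) fun k _ => ?_
  have := PiLp.norm_apply_le (x k) (corner hn ∅ k)
  rwa [hx k, Real.norm_eq_abs] at this

/-- Reduces a spectral norm bound to a polynomial inequality on m pairs (u_i, v_i) in the unit disc;
the remaining modes only contribute a factor of modulus at most 1. -/
theorem specNorm_le_of_form_eq (hn : ∀ k, 2 ≤ n k) {m : ℕ} (ι : Fin m ↪ Fin d) {S : Tensor n}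
    {c : ℝ} (P : (Fin m → ℝ) → (Fin m → ℝ) → ℝ)
    (hP : ∀ x, form S x = P (fun i => lo hn x (ι i)) (fun i => hi hn x (ι i)) *
      restFactor hn ι x)
    (hb : ∀ u v : Fin m → ℝ, (∀ i, u i ^ 2 + v i ^ 2 ≤ 1) → |P u v| ≤ c) : specNorm S ≤ c := by
  have hc : 0 ≤ c := (abs_nonneg _).trans (hb 0 0 (by simp))
  refine specNorm_le hc fun x hx => ?_
  rw [hP]
  refine (le_abs_self _).trans ?_
  rw [abs_mul]
  exact (mul_le_of_le_one_right (abs_nonneg _) (abs_restFactor_le hn ι hx)).trans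
    (hb _ _ fun i => lo_sq_add_hi_sq_le hn hx _)

/-- The vectors `c e₀ + s e₁` in the modes of `ι` and `e₀` in the others. -/
def testVec (hn : ∀ k, 2 ≤ n k) {m : ℕ} (ι : Fin m ↪ Fin d) (c s : ℝ) (k : Fin d) :
    EuclideanSpace ℝ (Fin (n k)) :=
  if k ∈ Finset.univ.map ι then c • cornerVec hn ∅ k + s • cornerVec hn Finset.univ k
  else cornerVec hn ∅ k

theorem abs_le_specNorm_of_form_eq (hd : 0 < d) (hn : ∀ k, 2 ≤ n k) {m : ℕ}
    (ι : Fin m ↪ Fin d) {S : Tensor n}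
    (P : (Fin m → ℝ) → (Fin m → ℝ) → ℝ)
    (hP : ∀ x, form S x = P (fun i => lo hn x (ι i)) (fun i => hi hn x (ι i)) *
      restFactor hn ι x) {c s : ℝ} (hcs : c ^ 2 + s ^ 2 = 1) :
    |P (fun _ => c) (fun _ => s)| ≤ specNorm S := by
  have hne : ∀ k, corner hn ∅ k ≠ corner hn Finset.univ k := fun k => by simp [corner_eq_iff]
  have hx : ∀ k, ‖testVec hn ι c s k‖ = 1 := by
    intro k
    unfold testVec
    split_ifs
    · have h : ‖c • cornerVec hn ∅ k + s • cornerVec hn Finset.univ k‖ ^ 2 = 1 := by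
        rw [norm_add_sq_real, norm_smul, norm_smul, real_inner_smul_left, real_inner_smul_right,
          cornerVec_norm, cornerVec_norm, cornerVec, cornerVec, EuclideanSpace.inner_single_left]
        simp [hne k, hcs]
      exact (pow_eq_one_iff_of_nonneg (norm_nonneg _) two_ne_zero).1 h
    · exact cornerVec_norm hn ∅ k
  have hlo : ∀ i, lo hn (testVec hn ι c s) (ι i) = c := by
    intro i
    simp [lo, testVec, cornerVec, hne]
  have hhi : ∀ i, hi hn (testVec hn ι c s) (ι i) = s := by
    intro i
    simp [hi, testVec, cornerVec, (hne _).symm]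
  have hrest : restFactor hn ι (testVec hn ι c s) = 1 := by
    refine Finset.prod_eq_one fun k hk => ?_
    rw [Finset.mem_compl] at hk
    simp only [testVec, if_neg hk]
    simp [cornerVec]
  have h := abs_form_le_specNorm hd S _ hx
  rw [hP, hrest, mul_one] at h
  simpa only [hlo, hhi] using h

/-! ### Thresholds at the rank-one tensor -/

/-- In the direction (e₀ + t e₁)/√(1 + t²) in mode k, Z + X takes the value √(1 + t²) > 1 for every
t > 0. -/
theorem lowerTauAt_base_singleton_le_zero (hd : 0 < d) (hn : ∀ k, 2 ≤ n k) (k : Fin d) :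
    lowerTauAt {{k}} (cornerTensor hn ∅) ≤ ((0 : ℝ) : EReal) := by
  refine lowerTauAt_le fun t ht => ⟨_, base_mem_certificates hd hn, t • cornerTensor hn {k},
    Submodule.smul_mem _ _ (cornerTensor_mem_sumSubspace hn (by simp)), ?_, ?_⟩
  · refine specNorm_le ht.le fun x hx => ?_
    rw [form_smul]
    exact mul_le_of_le_one_right ht.le
      ((form_le_specNorm _ x hx).trans (specNorm_cornerTensor_le hn _))
  · let ι : Fin 1 ↪ Fin d := ⟨fun _ => k, Function.injective_of_subsingleton _⟩
    have hpos : 0 < 1 + t ^ 2 := by positivity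
    have hr : √(1 + t ^ 2) ^ 2 = 1 + t ^ 2 := Real.sq_sqrt hpos.le
    have hr0 : 0 < √(1 + t ^ 2) := Real.sqrt_pos.2 hpos
    have h := abs_le_specNorm_of_form_eq (by omega) hn ι
      (S := cornerTensor hn ∅ + t • cornerTensor hn {k}) (fun u v => u 0 + t * v 0) (fun x => by
        have h0 := form_cornerTensor_map hn ι ∅ x
        have h1 := form_cornerTensor_map hn ι {0} x
        have e : ({0} : Finset (Fin 1)).map ι = {k} := by simp [ι]
        rw [Finset.map_empty] at h0
        rw [e] at h1
        rw [form_add, form_smul, h0, h1]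
        simp
        ring) (c := 1 / √(1 + t ^ 2)) (s := t / √(1 + t ^ 2)) (by
        rw [div_pow, div_pow, hr]
        field_simp)
    refine lt_of_lt_of_le ?_ ((le_abs_self _).trans h)
    have e : 1 / √(1 + t ^ 2) + t * (t / √(1 + t ^ 2)) = √(1 + t ^ 2) := by
      field_simp
      rw [hr]
    show 1 < 1 / √(1 + t ^ 2) + t * (t / √(1 + t ^ 2))
    rw [e, Real.lt_sqrt zero_le_one]
    nlinarith

theorem lowerTauAt_base_le_one (hd : 0 < d) (hn : ∀ k, 2 ≤ n k) {I : Finset (Fin d)}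
    (hI : I.Nonempty) : lowerTauAt {I} (cornerTensor hn ∅) ≤ ((1 : ℝ) : EReal) := by
  refine lowerTauAt_le fun t ht => ⟨_, base_mem_certificates hd hn, t • cornerTensor hn I,
    Submodule.smul_mem _ _ (cornerTensor_mem_sumSubspace hn (by simp)), ?_, ?_⟩
  · refine specNorm_le (by linarith) fun x hx => ?_
    rw [form_smul]
    exact mul_le_of_le_one_right (by linarith)
      ((form_le_specNorm _ x hx).trans (specNorm_cornerTensor_le hn _))
  · have h := form_le_specNorm (cornerTensor hn ∅ + t • cornerTensor hn I) (cornerVec hn I)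
      (cornerVec_norm hn I)
    rw [form_add, form_smul, form_cornerTensor_cornerVec, form_cornerTensor_cornerVec,
      if_neg hI.ne_empty.symm, if_pos rfl] at h
    linarith

theorem one_le_upperTauAt_base (hd : 0 < d) (hn : ∀ k, 2 ≤ n k) {I : Finset (Fin d)}
    (hI : 2 ≤ I.card) : ((1 : ℝ) : EReal) ≤ upperTauAt {I} (cornerTensor hn ∅) := by
  obtain ⟨i, hi, j, hj, hij⟩ := Finset.one_lt_card.1 hI
  have hX : cornerTensor hn I ∈ sumSubspace {I} (cornerTensor hn ∅) :=
    cornerTensor_mem_sumSubspace hn (by simp)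
  refine le_upperTauAt (base_mem_certificates hd hn) hX ?_ ?_
  · exact specNorm_add_le_of_common_modes hd hn hij (by simpa using hi) (by simpa using hj)
      (cornerTensor_mem_base hn ∅) (specNorm_cornerTensor_le hn ∅) hX
      (specNorm_cornerTensor_le hn I)
  · have h := form_le_specNorm (cornerTensor hn I) (cornerVec hn I) (cornerVec_norm hn I)
    rwa [form_cornerTensor_cornerVec, if_pos rfl] at h

/-! ### A possible threshold of a single mode -/

/-- `e₀⊗e₀⊗e₀ + e₀⊗e₁⊗e₁` in the modes of `ι`, padded by `e₀`. -/
def pairTensor (hn : ∀ k, 2 ≤ n k) (ι : Fin 3 ↪ Fin d) : Tensor n :=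
  cornerTensor hn ∅ + cornerTensor hn {ι 1, ι 2}

theorem pairTensor_apply_update_empty (hn : ∀ k, 2 ≤ n k) (ι : Fin 3 ↪ Fin d) (k : Fin d)
    (j : Fin (n k)) : pairTensor hn ι (Function.update (corner hn ∅) k j) =
      if j = corner hn ∅ k then 1 else 0 := by
  have hne : Function.update (corner hn ∅) k j ≠ corner hn {ι 1, ι 2} := by
    intro h
    obtain ⟨i, hi, hik⟩ : ∃ i ∈ ({ι 1, ι 2} : Finset (Fin d)), i ≠ k := by
      refine Finset.exists_mem_ne ?_ k
      rw [Finset.card_pair (by simp)]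
      norm_num
    have := congrFun h i
    rw [Function.update_of_ne hik, corner_eq_iff] at this
    simp [hi] at this
  simp [pairTensor, cornerTensor_apply, hne]

theorem pairTensor_apply_update_pair (hn : ∀ k, 2 ≤ n k) (ι : Fin 3 ↪ Fin d) (k : Fin d)
    (j : Fin (n k)) : pairTensor hn ι (Function.update (corner hn {ι 1, ι 2}) k j) =
      if j = corner hn {ι 1, ι 2} k then 1 else 0 := by
  have hne : Function.update (corner hn {ι 1, ι 2}) k j ≠ corner hn ∅ := by
    intro h
    obtain ⟨i, hi, hik⟩ : ∃ i ∈ ({ι 1, ι 2} : Finset (Fin d)), i ≠ k := by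
      refine Finset.exists_mem_ne ?_ k
      rw [Finset.card_pair (by simp)]
      norm_num
    have := congrFun h i
    rw [Function.update_of_ne hik, corner_eq_iff] at this
    simp [hi] at this
  simp [pairTensor, cornerTensor_apply, hne]

theorem cornerVec_mem_modeSpan_pairTensor (hn : ∀ k, 2 ≤ n k) (ι : Fin 3 ↪ Fin d)
    {K : Finset (Fin d)} {k : Fin d} (h : k ∈ K → k ∈ ({ι 1, ι 2} : Finset (Fin d))) :
    cornerVec hn K k ∈ modeSpan (pairTensor hn ι) k := by
  by_cases hk : k ∈ K
  · have e : cornerVec hn K k = cornerVec hn {ι 1, ι 2} k := by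
      rw [cornerVec, cornerVec, (corner_eq_iff hn _ _ k).2 (iff_of_true hk (h hk))]
    rw [e]
    exact cornerVec_mem_modeSpan hn (pairTensor_apply_update_pair hn ι k)
  · have e : cornerVec hn K k = cornerVec hn ∅ k := by
      rw [cornerVec, cornerVec, (corner_eq_iff hn K ∅ k).2 (iff_of_false hk (by simp))]
    rw [e]
    exact cornerVec_mem_modeSpan hn (pairTensor_apply_update_empty hn ι k)

theorem cornerVec_mem_orthogonal_pairTensor (hn : ∀ k, 2 ≤ n k) (ι : Fin 3 ↪ Fin d)
    {K : Finset (Fin d)} (h : ι 0 ∈ K) :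
    cornerVec hn K (ι 0) ∈ (modeSpan (pairTensor hn ι) (ι 0))ᗮ := by
  refine cornerVec_mem_orthogonal hn fun i => ?_
  have key : ∀ K' : Finset (Fin d), ι 0 ∉ K' →
      Function.update i (ι 0) (corner hn K (ι 0)) ≠ corner hn K' := by
    intro K' hK' heq
    have := congrFun heq (ι 0)
    rw [Function.update_self, corner_eq_iff] at this
    exact hK' (this.1 h)
  simp [pairTensor, cornerTensor_apply, key ∅ (by simp), key {ι 1, ι 2} (by simp)]

theorem form_pairTensor (hn : ∀ k, 2 ≤ n k) (ι : Fin 3 ↪ Fin d)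
    (x : (k : Fin d) → EuclideanSpace ℝ (Fin (n k))) :
    form (pairTensor hn ι) x = lo hn x (ι 0) * (lo hn x (ι 1) * lo hn x (ι 2) +
      hi hn x (ι 1) * hi hn x (ι 2)) * restFactor hn ι x := by
  have h0 := form_cornerTensor_map hn ι ∅ x
  have h1 := form_cornerTensor_map hn ι {1, 2} x
  have e : ({1, 2} : Finset (Fin 3)).map ι = {ι 1, ι 2} := by simp
  rw [Finset.map_empty] at h0
  rw [e] at h1
  rw [pairTensor, form_add, h0, h1]
  simp [Fin.prod_univ_three]
  ring

theorem pairTensor_mem_certificates (hd : 0 < d) (hn : ∀ k, 2 ≤ n k) (ι : Fin 3 ↪ Fin d) :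
    pairTensor hn ι ∈ certificates (pairTensor hn ι) := by
  refine mem_certificates hd two_pos (Submodule.add_mem _ ?_ ?_) ?_
    ![cornerVec hn ∅, cornerVec hn {ι 1, ι 2}] ?_ ?_ ?_
  · exact cornerTensor_mem_basicSubspace hn (by simp)
      fun k _ => cornerVec_mem_modeSpan_pairTensor hn ι (by simp)
  · exact cornerTensor_mem_basicSubspace hn (by simp)
      fun k _ => cornerVec_mem_modeSpan_pairTensor hn ι id
  · refine specNorm_le_of_form_eq hn ι (fun u v => u 0 * (u 1 * u 2 + v 1 * v 2))
      (form_pairTensor hn ι) fun u v h => ?_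
    have h0 := h 0
    have h1 : |u 1 * u 2 + v 1 * v 2| ≤ 1 := by
      refine abs_le'.2 ⟨mul_add_mul_le_one (h 1) (h 2), ?_⟩
      have := mul_add_mul_le_one (c := -u 1) (s := -v 1) (by simpa using h 1) (h 2)
      linarith
    have h2 : |u 0| ≤ 1 := abs_le_one_iff_mul_self_le_one.2 (by nlinarith [sq_nonneg (v 0)])
    rw [abs_mul]
    exact mul_le_one₀ h2 (abs_nonneg _) h1
  · intro i k
    fin_cases i <;> exact cornerVec_norm hn _ k
  · simp [pairTensor, cornerTensor_eq_outer]
  · have hne : ({ι 1, ι 2} : Finset (Fin d)) ≠ ∅ := Finset.insert_ne_empty _ _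
    rw [pairTensor, inner_add_left, inner_add_right, inner_add_right, inner_cornerTensor,
      inner_cornerTensor, inner_cornerTensor, inner_cornerTensor, if_pos rfl, if_neg hne,
      if_neg hne.symm, if_pos rfl]
    norm_num

/-- X is e₁ ⊗ (e₁⊗e₀ - e₀⊗e₁) in the modes of ι. The forms of Z and X contain the dot product and
the determinant of two plane vectors, whose squares add up to the product of the squared lengths, so
Z + X has norm at most 1. -/
theorem one_le_upperTauAt_pairTensor (hd : 0 < d) (hn : ∀ k, 2 ≤ n k) (ι : Fin 3 ↪ Fin d) :
    ((1 : ℝ) : EReal) ≤ upperTauAt {{ι 0}} (pairTensor hn ι) := by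
  have hmem : ∀ i : Fin 3, i ≠ 0 →
      cornerTensor hn {ι 0, ι i} ∈ sumSubspace {{ι 0}} (pairTensor hn ι) := by
    intro i hi
    have : cornerTensor hn {ι 0, ι i} ∈ basicSubspace (pairTensor hn ι) {ι 0} := by
      refine cornerTensor_mem_basicSubspace hn (fun k hk => ?_) fun k hk => ?_
      · rw [Finset.mem_singleton] at hk
        subst hk
        exact cornerVec_mem_orthogonal_pairTensor hn ι (by simp)
      · rw [Finset.mem_singleton] at hk
        refine cornerVec_mem_modeSpan_pairTensor hn ι fun hk' => ?_
        have hki : k = ι i := by simpa [hk] using hk'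
        subst hki
        fin_cases i <;> simp at hi ⊢
    simpa [sumSubspace] using this
  refine le_upperTauAt (X := cornerTensor hn {ι 0, ι 1} - cornerTensor hn {ι 0, ι 2})
    (pairTensor_mem_certificates hd hn ι)
    (Submodule.sub_mem _ (hmem 1 (by decide)) (hmem 2 (by decide))) ?_ ?_
  · refine specNorm_le_of_form_eq hn ι (fun u v => u 0 * (u 1 * u 2 + v 1 * v 2) +
      v 0 * (v 1 * u 2 - u 1 * v 2)) (fun x => ?_) fun u v h => ?_
    · have h1 := form_cornerTensor_map hn ι {0, 1} x
      have h2 := form_cornerTensor_map hn ι {0, 2} x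
      have e1 : ({0, 1} : Finset (Fin 3)).map ι = {ι 0, ι 1} := by simp
      have e2 : ({0, 2} : Finset (Fin 3)).map ι = {ι 0, ι 2} := by simp
      rw [e1] at h1
      rw [e2] at h2
      rw [form_add, form_sub, form_pairTensor, h1, h2]
      simp [Fin.prod_univ_three]
      ring
    · have key : (u 1 * u 2 + v 1 * v 2) ^ 2 + (v 1 * u 2 - u 1 * v 2) ^ 2 ≤ 1 := by
        have e : (u 1 * u 2 + v 1 * v 2) ^ 2 + (v 1 * u 2 - u 1 * v 2) ^ 2 =
          (u 1 ^ 2 + v 1 ^ 2) * (u 2 ^ 2 + v 2 ^ 2) := by ring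
        rw [e]
        exact mul_le_one₀ (h 1) (by positivity) (h 2)
      refine abs_le'.2 ⟨mul_add_mul_le_one (h 0) key, ?_⟩
      have := mul_add_mul_le_one (c := -u 0) (s := -v 0) (by simpa using h 0) key
      linarith
  · have h := form_le_specNorm (cornerTensor hn {ι 0, ι 1} - cornerTensor hn {ι 0, ι 2})
      (cornerVec hn {ι 0, ι 1}) (cornerVec_norm hn _)
    have hne : ({ι 0, ι 2} : Finset (Fin d)) ≠ {ι 0, ι 1} := by
      intro h
      have : ι 2 ∈ ({ι 0, ι 1} : Finset (Fin d)) := h ▸ by simp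
      simp at this
    rwa [form_sub, form_cornerTensor_cornerVec, form_cornerTensor_cornerVec, if_pos rfl,
      if_neg hne, sub_zero] at h

/-! ### Sums over pairs of modes -/

theorem map_mem_cardAtLeast {m r : ℕ} (ι : Fin m ↪ Fin d) {K : Finset (Fin m)}
    (h : r ≤ K.card) : K.map ι ∈ cardAtLeast d r := by
  simpa [cardAtLeast] using h

/-- The sum of the three corner tensors over pairs of the modes of `ι`. -/
def pairSumThree (hn : ∀ k, 2 ≤ n k) (ι : Fin 3 ↪ Fin d) : Tensor n :=
  cornerTensor hn (Finset.map ι {0, 1}) + cornerTensor hn (Finset.map ι {0, 2}) +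
    cornerTensor hn (Finset.map ι {1, 2})

theorem pairSumThree_mem (hn : ∀ k, 2 ≤ n k) (ι : Fin 3 ↪ Fin d) :
    pairSumThree hn ι ∈ sumSubspace (cardAtLeast d 2) (cornerTensor hn ∅) := by
  refine Submodule.add_mem _ (Submodule.add_mem _ ?_ ?_) ?_ <;>
  exact cornerTensor_mem_sumSubspace hn (map_mem_cardAtLeast ι (by decide))

theorem form_pairSumThree (hn : ∀ k, 2 ≤ n k) (ι : Fin 3 ↪ Fin d)
    (x : (k : Fin d) → EuclideanSpace ℝ (Fin (n k))) :
    form (pairSumThree hn ι) x =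
      (hi hn x (ι 0) * hi hn x (ι 1) * lo hn x (ι 2) +
        hi hn x (ι 0) * lo hn x (ι 1) * hi hn x (ι 2) +
        lo hn x (ι 0) * hi hn x (ι 1) * hi hn x (ι 2)) * restFactor hn ι x := by
  rw [pairSumThree, form_add, form_add, form_cornerTensor_map, form_cornerTensor_map,
    form_cornerTensor_map]
  simp [Fin.prod_univ_three]
  ring

theorem form_base_three (hn : ∀ k, 2 ≤ n k) (ι : Fin 3 ↪ Fin d)
    (x : (k : Fin d) → EuclideanSpace ℝ (Fin (n k))) :
    form (cornerTensor hn ∅) x =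
      lo hn x (ι 0) * lo hn x (ι 1) * lo hn x (ι 2) * restFactor hn ι x := by
  rw [← Finset.map_empty ι, form_cornerTensor_map]
  simp [Fin.prod_univ_three]

theorem mul_abs_add_le_one {p q u v u' v' : ℝ} (hp : p = u * u') (hq : q = v * v')
    (h : u ^ 2 + v ^ 2 ≤ 1) (h' : u' ^ 2 + v' ^ 2 ≤ 1) : |p| + |q| ≤ 1 := by
  rw [hp, hq, abs_mul, abs_mul]
  exact mul_add_mul_le_one (by simpa using h) (by simpa using h')

theorem sq_rotation_le_one {u v u' v' : ℝ} (h : u ^ 2 + v ^ 2 ≤ 1) (h' : u' ^ 2 + v' ^ 2 ≤ 1) :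
    (v * u' + u * v') ^ 2 + (u * u' - v * v') ^ 2 ≤ 1 := by
  have e : (v * u' + u * v') ^ 2 + (u * u' - v * v') ^ 2 =
      (u ^ 2 + v ^ 2) * (u' ^ 2 + v' ^ 2) := by ring
  rw [e]
  exact mul_le_one₀ h (by positivity) h'

theorem abs_pairSumThree_le {u v : Fin 3 → ℝ} (h : ∀ i, u i ^ 2 + v i ^ 2 ≤ 1) :
    |v 0 * v 1 * u 2 + v 0 * u 1 * v 2 + u 0 * v 1 * v 2| ≤ 2 / √3 := by
  have r : √3 ^ 2 = 3 := Real.sq_sqrt (by norm_num)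
  have hw := sq_rotation_le_one (h 0) (h 1)
  have hpq := mul_abs_add_le_one rfl rfl (h 0) (h 1)
  have e : v 0 * v 1 * u 2 + v 0 * u 1 * v 2 + u 0 * v 1 * v 2 =
      v 0 * v 1 * u 2 + (v 0 * u 1 + u 0 * v 1) * v 2 := by ring
  rw [e]
  generalize v 0 * u 1 + u 0 * v 1 = w at *
  generalize u 0 * u 1 = p at *
  generalize v 0 * v 1 = q at *
  refine abs_le_of_sq_le_sq ?_ (by positivity)
  rw [div_pow, r]
  have cs : (q * u 2 + w * v 2) ^ 2 ≤ q ^ 2 + w ^ 2 := by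
    have e₁ : (q * u 2 + w * v 2) ^ 2 + (q * v 2 - w * u 2) ^ 2 =
      (q ^ 2 + w ^ 2) * (u 2 ^ 2 + v 2 ^ 2) := by ring
    have e₂ := mul_le_of_le_one_right (by positivity : 0 ≤ q ^ 2 + w ^ 2) (h 2)
    linarith [sq_nonneg (q * v 2 - w * u 2)]
  have hpq' : p * q ≤ |p| * (1 - |p|) := by
    refine (le_abs_self _).trans ?_
    rw [abs_mul]
    exact mul_le_mul_of_nonneg_left (by linarith) (abs_nonneg _)
  have hp2 := sq_abs p
  -- q² + w² ≤ 1 + 2pq - p² ≤ 1 + 2|p| - 3p², which is 4/3 - (3|p| - 1)²/3.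
  nlinarith [sq_nonneg (3 * |p| - 1)]

theorem lowerTauAt_base_le_of_three (hd : 3 ≤ d) (hn : ∀ k, 2 ≤ n k) :
    lowerTauAt (cardAtLeast d 2) (cornerTensor hn ∅) ≤ ((1 / √3 : ℝ) : EReal) := by
  let ι : Fin 3 ↪ Fin d := Fin.castLEEmb hd
  have r : √3 ^ 2 = 3 := Real.sq_sqrt (by norm_num)
  have r0 : 0 < √3 := Real.sqrt_pos.2 (by norm_num)
  refine lowerTauAt_le fun t ht => ⟨_, base_mem_certificates (by omega) hn,
    (t * √3 / 2) • pairSumThree hn ι, Submodule.smul_mem _ _ (pairSumThree_mem hn ι), ?_, ?_⟩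
  · have ht0 : 0 < t := lt_trans (by positivity) ht
    refine specNorm_le_of_form_eq hn ι (fun u v => t * √3 / 2 *
      (v 0 * v 1 * u 2 + v 0 * u 1 * v 2 + u 0 * v 1 * v 2)) (fun x => ?_) fun u v h => ?_
    · rw [form_smul, form_pairSumThree]
      ring
    · rw [abs_mul, abs_of_pos (by positivity)]
      refine (mul_le_mul_of_nonneg_left (abs_pairSumThree_le h) (by positivity)).trans (le_of_eq ?_)
      field_simp
  · have hβ : 1 < t * √3 := (div_lt_iff₀ r0).1 ht
    -- At equal vectors with s² = w the form is √(1 - w)(1 + γw). Its square is 1 + (2γ - 1)w to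
    -- first order, and 2γ > 1 exactly when t > 1/√3; the chosen w is small enough.
    obtain ⟨γ, hγ⟩ : ∃ γ : ℝ, γ = 3 * (t * √3 / 2) - 1 := ⟨_, rfl⟩
    have hγ0 : 1 / 2 < γ := by linarith
    obtain ⟨w, hw⟩ : ∃ w : ℝ, w = (2 * γ - 1) / (4 * γ) := ⟨_, rfl⟩
    have hwγ : 4 * γ * w = 2 * γ - 1 := by
      rw [hw]
      have : γ ≠ 0 := by linarith
      field_simp
    have hw0 : 0 < w := by
      rw [hw]
      exact div_pos (by linarith) (by linarith)
    have hw1 : w < 1 := by nlinarith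
    have hc : √(1 - w) ^ 2 = 1 - w := Real.sq_sqrt (by linarith)
    have hs : √w ^ 2 = w := Real.sq_sqrt hw0.le
    have h := abs_le_specNorm_of_form_eq (by omega) hn ι
      (S := cornerTensor hn ∅ + (t * √3 / 2) • pairSumThree hn ι)
      (fun u v => u 0 * u 1 * u 2 + t * √3 / 2 *
        (v 0 * v 1 * u 2 + v 0 * u 1 * v 2 + u 0 * v 1 * v 2)) (fun x => by
        rw [form_add, form_smul, form_pairSumThree, form_base_three hn ι]
        ring) (c := √(1 - w)) (s := √w) (by rw [hc, hs]; ring)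
    refine lt_of_lt_of_le ?_ ((le_abs_self _).trans h)
    have e : √(1 - w) * √(1 - w) * √(1 - w) + t * √3 / 2 *
        (√w * √w * √(1 - w) + √w * √(1 - w) * √w + √(1 - w) * √w * √w) =
        √(1 - w) * (1 + γ * w) := by
      linear_combination √(1 - w) * hc + 3 * (t * √3 / 2) * √(1 - w) * hs - √(1 - w) * w * hγ
    show 1 < √(1 - w) * √(1 - w) * √(1 - w) + t * √3 / 2 *
        (√w * √w * √(1 - w) + √w * √(1 - w) * √w + √(1 - w) * √w * √w)
    rw [e]
    have hpos : 0 ≤ √(1 - w) * (1 + γ * w) := by positivity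
    refine lt_of_pow_lt_pow_left₀ 2 hpos ?_
    rw [mul_pow, hc, one_pow]
    have e₂ : (1 - w) * (1 + γ * w) ^ 2 - 1 =
        1 / 2 * w * (2 * γ - 1) + (1 - w) * (γ * w) ^ 2 := by
      linear_combination (-1 / 2 * w) * hwγ
    have : 0 < 1 / 2 * w * (2 * γ - 1) := mul_pos (by linarith) (by linarith)
    have : 0 ≤ (1 - w) * (γ * w) ^ 2 := mul_nonneg (by linarith) (sq_nonneg _)
    linarith

/-- Z + X has the form Re ∏ (u_k + i v_k) over three modes, of modulus at most 1. -/
theorem le_upperTauAt_base_of_three (hd : 3 ≤ d) (hn : ∀ k, 2 ≤ n k) :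
    ((2 / √3 : ℝ) : EReal) ≤ upperTauAt (cardAtLeast d 2) (cornerTensor hn ∅) := by
  let ι : Fin 3 ↪ Fin d := Fin.castLEEmb hd
  have r : √3 ^ 2 = 3 := Real.sq_sqrt (by norm_num)
  have r0 : 0 < √3 := Real.sqrt_pos.2 (by norm_num)
  refine le_upperTauAt (X := (-1 : ℝ) • pairSumThree hn ι) (base_mem_certificates (by omega) hn)
    (Submodule.smul_mem _ _ (pairSumThree_mem hn ι)) ?_ ?_
  · refine specNorm_le_of_form_eq hn ι (fun u v => (u 0 * u 1 - v 0 * v 1) * u 2 -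
      (v 0 * u 1 + u 0 * v 1) * v 2) (fun x => ?_) fun u v h => ?_
    · rw [form_add, form_smul, form_pairSumThree, form_base_three hn ι]
      ring
    · have hw := sq_rotation_le_one (h 0) (h 1)
      have hw' : (u 0 * u 1 - v 0 * v 1) ^ 2 + (-(v 0 * u 1 + u 0 * v 1)) ^ 2 ≤ 1 := by linarith
      have h1 := mul_add_mul_le_one hw' (h 2)
      have h2 := mul_add_mul_le_one hw' (c' := -u 2) (s' := -v 2) (by simpa using h 2)
      exact abs_le'.2 ⟨by linarith, by linarith⟩
  · have h := abs_le_specNorm_of_form_eq (by omega) hn ι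
      (S := (-1 : ℝ) • pairSumThree hn ι)
      (fun u v => -(v 0 * v 1 * u 2 + v 0 * u 1 * v 2 + u 0 * v 1 * v 2)) (fun x => by
        rw [form_smul, form_pairSumThree]
        ring) (c := -(1 / √3)) (s := √(2 / 3)) (by
        rw [Real.sq_sqrt (by norm_num), neg_sq, div_pow, r]; norm_num)
    refine le_trans (le_of_eq ?_) ((le_abs_self _).trans h)
    have hs : √(2 / 3) ^ 2 = 2 / 3 := Real.sq_sqrt (by norm_num)
    show 2 / √3 = -(√(2 / 3) * √(2 / 3) * -(1 / √3) + √(2 / 3) * -(1 / √3) * √(2 / 3) +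
      -(1 / √3) * √(2 / 3) * √(2 / 3))
    linear_combination (-3 * (1 / √3)) * hs

/-- The sum of the six corner tensors over pairs of the modes of `ι`. -/
def pairSumFour (hn : ∀ k, 2 ≤ n k) (ι : Fin 4 ↪ Fin d) : Tensor n :=
  cornerTensor hn (Finset.map ι {0, 1}) + cornerTensor hn (Finset.map ι {0, 2}) +
    cornerTensor hn (Finset.map ι {0, 3}) + cornerTensor hn (Finset.map ι {1, 2}) +
    cornerTensor hn (Finset.map ι {1, 3}) + cornerTensor hn (Finset.map ι {2, 3})

theorem pairSumFour_mem (hn : ∀ k, 2 ≤ n k) (ι : Fin 4 ↪ Fin d) :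
    pairSumFour hn ι ∈ sumSubspace (cardAtLeast d 2) (cornerTensor hn ∅) := by
  refine Submodule.add_mem _ (Submodule.add_mem _ (Submodule.add_mem _ (Submodule.add_mem _
    (Submodule.add_mem _ ?_ ?_) ?_) ?_) ?_) ?_ <;>
  exact cornerTensor_mem_sumSubspace hn (map_mem_cardAtLeast ι (by decide))

/-- The form of `pairSumFour` in coordinates. -/
def pairPoly (u v : Fin 4 → ℝ) : ℝ :=
  v 0 * v 1 * (u 2 * u 3) + u 0 * u 1 * (v 2 * v 3) +
    (v 0 * u 1 + u 0 * v 1) * (v 2 * u 3 + u 2 * v 3)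

theorem form_pairSumFour (hn : ∀ k, 2 ≤ n k) (ι : Fin 4 ↪ Fin d)
    (x : (k : Fin d) → EuclideanSpace ℝ (Fin (n k))) :
    form (pairSumFour hn ι) x =
      pairPoly (fun i => lo hn x (ι i)) (fun i => hi hn x (ι i)) * restFactor hn ι x := by
  simp only [pairSumFour, form_add, form_cornerTensor_map, pairPoly]
  simp [Fin.prod_univ_four]
  ring

theorem form_base_four (hn : ∀ k, 2 ≤ n k) (ι : Fin 4 ↪ Fin d)
    (x : (k : Fin d) → EuclideanSpace ℝ (Fin (n k))) :
    form (cornerTensor hn ∅) x = lo hn x (ι 0) * lo hn x (ι 1) * lo hn x (ι 2) *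
      lo hn x (ι 3) * restFactor hn ι x := by
  rw [← Finset.map_empty ι, form_cornerTensor_map]
  simp [Fin.prod_univ_four]

theorem form_top_four (hn : ∀ k, 2 ≤ n k) (ι : Fin 4 ↪ Fin d)
    (x : (k : Fin d) → EuclideanSpace ℝ (Fin (n k))) :
    form (cornerTensor hn (Finset.univ.map ι)) x = hi hn x (ι 0) * hi hn x (ι 1) *
      hi hn x (ι 2) * hi hn x (ι 3) * restFactor hn ι x := by
  rw [form_cornerTensor_map]
  simp [Fin.prod_univ_four]

/-- Here p - q and w are the real and imaginary parts of (u₀ + iv₀)(u₁ + iv₁), and likewise for p' -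
q' and w'. The term in p + q and p' + q' contributes at most 1/2, the other two together at most 1.
-/
theorem abs_pairPoly_le {u v : Fin 4 → ℝ} (h : ∀ i, u i ^ 2 + v i ^ 2 ≤ 1) :
    |pairPoly u v| ≤ 3 / 2 := by
  have hw := sq_rotation_le_one (h 0) (h 1)
  have hpq := mul_abs_add_le_one rfl rfl (h 0) (h 1)
  have hw' := sq_rotation_le_one (h 2) (h 3)
  have hpq' := mul_abs_add_le_one rfl rfl (h 2) (h 3)
  unfold pairPoly
  generalize v 0 * u 1 + u 0 * v 1 = w at *
  generalize u 0 * u 1 = p at *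
  generalize v 0 * v 1 = q at *
  generalize v 2 * u 3 + u 2 * v 3 = w' at *
  generalize u 2 * u 3 = p' at *
  generalize v 2 * v 3 = q' at *
  have e : q * p' + p * q' + w * w' =
      1 / 2 * ((p + q) * (p' + q')) - 1 / 2 * ((p - q) * (p' - q')) + w * w' := by ring
  have h1 : |(p + q) * (p' + q')| ≤ 1 := by
    rw [abs_mul]
    exact mul_le_one₀ ((abs_add_le _ _).trans hpq) (abs_nonneg _) ((abs_add_le _ _).trans hpq')
  have h2 : |(p - q) * (p' - q')| + |w * w'| ≤ 1 := mul_abs_add_le_one rfl rfl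
    ((add_comm _ _).trans_le hw) ((add_comm _ _).trans_le hw')
  rw [e]
  have a1 := abs_le.1 h1
  have a2 := neg_abs_le ((p - q) * (p' - q'))
  have a3 := le_abs_self ((p - q) * (p' - q'))
  have a4 := neg_abs_le (w * w')
  have a5 := le_abs_self (w * w')
  have a6 := abs_nonneg (w * w')
  exact abs_le.2 ⟨by linarith [a1.1], by linarith [a1.2]⟩

theorem lowerTauAt_base_le_of_four (hd : 4 ≤ d) (hn : ∀ k, 2 ≤ n k) :
    lowerTauAt (cardAtLeast d 2) (cornerTensor hn ∅) ≤ ((1 / 2 : ℝ) : EReal) := by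
  let ι : Fin 4 ↪ Fin d := Fin.castLEEmb hd
  refine lowerTauAt_le fun t ht => ⟨_, base_mem_certificates (by omega) hn,
    (2 / 3 * t) • pairSumFour hn ι, Submodule.smul_mem _ _ (pairSumFour_mem hn ι), ?_, ?_⟩
  · refine specNorm_le_of_form_eq hn ι (fun u v => 2 / 3 * t * pairPoly u v)
      (fun x => ?_) fun u v h => ?_
    · rw [form_smul, form_pairSumFour]
      ring
    · rw [abs_mul, abs_of_pos (by linarith)]
      nlinarith [abs_pairPoly_le h]
  -- At equal vectors with s² = w the form is 1 + δw - (1 + δ)w². The w below maximises it, with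
  -- value 1 + δw/2.
  · obtain ⟨δ, hδ⟩ : ∃ δ : ℝ, δ = 4 * t - 2 := ⟨_, rfl⟩
    have hδ0 : 0 < δ := by linarith
    obtain ⟨w, hw⟩ : ∃ w : ℝ, w = δ / (2 * (1 + δ)) := ⟨_, rfl⟩
    have hwδ : 2 * (1 + δ) * w = δ := by
      rw [hw]
      field_simp
    have hw0 : 0 < w := by
      rw [hw]
      positivity
    have hw1 : w < 1 := by nlinarith
    have hc : √(1 - w) ^ 2 = 1 - w := Real.sq_sqrt (by linarith)
    have hs : √w ^ 2 = w := Real.sq_sqrt hw0.le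
    have h := abs_le_specNorm_of_form_eq (by omega) hn ι
      (S := cornerTensor hn ∅ + (2 / 3 * t) • pairSumFour hn ι)
      (fun u v => u 0 * u 1 * u 2 * u 3 + 2 / 3 * t * pairPoly u v) (fun x => by
        rw [form_add, form_smul, form_pairSumFour, form_base_four hn ι]
        ring) (c := √(1 - w)) (s := √w) (by rw [hc, hs]; ring)
    refine lt_of_lt_of_le ?_ ((le_abs_self _).trans h)
    have e : √(1 - w) * √(1 - w) * √(1 - w) * √(1 - w) +
        2 / 3 * t * pairPoly (fun _ => √(1 - w)) (fun _ => √w) =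
        (√(1 - w) ^ 2) ^ 2 + 4 * t * (√(1 - w) ^ 2 * √w ^ 2) := by
      unfold pairPoly
      ring
    show 1 < √(1 - w) * √(1 - w) * √(1 - w) * √(1 - w) +
        2 / 3 * t * pairPoly (fun _ => √(1 - w)) (fun _ => √w)
    rw [e, hc, hs]
    have e₂ : (1 - w) ^ 2 + 4 * t * ((1 - w) * w) = 1 + 1 / 2 * w * δ := by
      linear_combination -(1 - w) * w * hδ - 1 / 2 * w * hwδ
    rw [e₂]
    have : 0 < 1 / 2 * w * δ := by positivity
    linarith

/-- Z + X has the form Re ∏ (u_k + i v_k) over four modes, written as a product of two complex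
numbers. -/
theorem le_upperTauAt_base_of_four (hd : 4 ≤ d) (hn : ∀ k, 2 ≤ n k) :
    (((1 + √2) / 2 : ℝ) : EReal) ≤ upperTauAt (cardAtLeast d 2) (cornerTensor hn ∅) := by
  let ι : Fin 4 ↪ Fin d := Fin.castLEEmb hd
  refine le_upperTauAt (X := cornerTensor hn (Finset.univ.map ι) - pairSumFour hn ι)
    (base_mem_certificates (by omega) hn)
    (Submodule.sub_mem _ (cornerTensor_mem_sumSubspace hn (map_mem_cardAtLeast ι (by decide)))
      (pairSumFour_mem hn ι)) ?_ ?_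
  · refine specNorm_le_of_form_eq hn ι (fun u v => (u 0 * u 1 - v 0 * v 1) *
      (u 2 * u 3 - v 2 * v 3) - (v 0 * u 1 + u 0 * v 1) * (v 2 * u 3 + u 2 * v 3))
      (fun x => ?_) fun u v h => ?_
    · rw [form_add, form_sub, form_pairSumFour, form_base_four hn ι, form_top_four, pairPoly]
      ring
    · have hw := sq_rotation_le_one (h 0) (h 1)
      have hw' := sq_rotation_le_one (h 2) (h 3)
      have h1 := mul_abs_add_le_one rfl rfl ((add_comm _ _).trans_le hw)
        ((add_comm _ _).trans_le hw')
      exact (abs_sub _ _).trans h1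
  -- At equal vectors -X is 6c²s² - s⁴, maximal at s² = 3/7 with value 9/7, which exceeds (1 +
  -- √2)/2.
  · have h := abs_le_specNorm_of_form_eq (by omega) hn ι
      (S := cornerTensor hn (Finset.univ.map ι) - pairSumFour hn ι)
      (fun u v => v 0 * v 1 * v 2 * v 3 - pairPoly u v) (fun x => by
        rw [form_sub, form_pairSumFour, form_top_four]
        ring) (c := √(4 / 7)) (s := √(3 / 7)) (by
        rw [Real.sq_sqrt (by norm_num), Real.sq_sqrt (by norm_num)]; norm_num)
    have hc : √(4 / 7) ^ 2 = 4 / 7 := Real.sq_sqrt (by norm_num)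
    have hs : √(3 / 7) ^ 2 = 3 / 7 := Real.sq_sqrt (by norm_num)
    have e : √(3 / 7) * √(3 / 7) * √(3 / 7) * √(3 / 7) -
        pairPoly (fun _ => √(4 / 7)) (fun _ => √(3 / 7)) =
        (√(3 / 7) ^ 2) ^ 2 - 6 * (√(4 / 7) ^ 2 * √(3 / 7) ^ 2) := by
      unfold pairPoly
      ring
    have h' := (neg_le_abs _).trans h
    rw [e, hc, hs] at h'
    have h2 : √2 ≤ 11 / 7 := Real.sqrt_le_iff.2 (by norm_num)
    linarith

/-! ### The exact values -/

theorem singleton_subset_supersets (I : Finset (Fin d)) : {I} ⊆ supersets I := by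
  simp [supersets]

theorem subset_of_mem_supersets {I K : Finset (Fin d)} (h : K ∈ supersets I) : I ⊆ K := by
  simpa [supersets] using h

theorem lowerTau_eq_zero (hd : 0 < d) (hn : ∀ k, 2 ≤ n k) {J : Finset (Finset (Fin d))}
    {k : Fin d} (h : {k} ∈ J) : lowerTau n J = 0 ∧ LowerAttained n J :=
  lowerTau_eq_and_attained (cornerTensor hn ∅) (zero_le_lowerTauAt hd hn J)
    ((lowerTauAt_anti (Finset.singleton_subset_iff.2 h) _).trans
      (lowerTauAt_base_singleton_le_zero hd hn k))

theorem lowerTau_eq_one (hd : 0 < d) (hn : ∀ k, 2 ≤ n k) {J : Finset (Finset (Fin d))}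
    {I : Finset (Fin d)} (hI : 2 ≤ I.card) (h : I ∈ J) (hJ : ∀ K ∈ J, I ⊆ K) :
    lowerTau n J = 1 ∧ LowerAttained n J := by
  obtain ⟨i, hi, j, hj, hij⟩ := Finset.one_lt_card.1 hI
  refine lowerTau_eq_and_attained (cornerTensor hn ∅) (fun T => ?_)
    ((lowerTauAt_anti (Finset.singleton_subset_iff.2 h) _).trans
      (lowerTauAt_base_le_one hd hn ⟨i, hi⟩))
  rw [← EReal.coe_one]
  exact le_lowerTauAt fun Z hZ hZ1 X hX hX1 => specNorm_add_le_of_common_modes hd hn hij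
    (fun K hK => hJ K hK hi) (fun K hK => hJ K hK hj) hZ hZ1 hX hX1

theorem upperTauAt_le_one (hd : 0 < d) (hn : ∀ k, 2 ≤ n k) {J : Finset (Finset (Fin d))}
    {I : Finset (Fin d)} (hI : I.Nonempty) (hJ : ∀ K ∈ J, I ⊆ K) (T : Tensor n) :
    upperTauAt J T ≤ 1 := by
  obtain ⟨i, hi⟩ := hI
  rw [← EReal.coe_one]
  exact upperTauAt_le fun Z hZ _ X hX hS =>
    specNorm_le_of_common_mode hd hn (fun K hK => hJ K hK hi) hZ hX hS

theorem upperTau_eq_one (hd : 3 ≤ d) (hn : ∀ k, 2 ≤ n k) {J : Finset (Finset (Fin d))}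
    {I : Finset (Fin d)} (hI : 1 ≤ I.card) (h : I ∈ J) (hJ : ∀ K ∈ J, I ⊆ K) :
    upperTau n J = 1 ∧ UpperAttained n J := by
  have hle := upperTauAt_le_one (n := n) (by omega) hn (Finset.card_pos.1 hI) hJ
  have hmono := fun T : Tensor n => upperTauAt_mono (Finset.singleton_subset_iff.2 h) T
  rcases hI.eq_or_lt with h1 | h2
  · obtain ⟨k, rfl⟩ := Finset.card_eq_one.1 h1.symm
    -- The swap moves the prescribed mode k to the position ι 0.
    let ι : Fin 3 ↪ Fin d :=
      (Fin.castLEEmb hd).trans (Equiv.swap (Fin.castLE hd 0) k).toEmbedding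
    have hk : ι 0 = k := by simp [ι]
    refine upperTau_eq_and_attained (pairTensor hn ι) hle (le_trans ?_ (hmono _))
    rw [← hk]
    exact one_le_upperTauAt_pairTensor (by omega) hn ι
  · exact upperTau_eq_and_attained (cornerTensor hn ∅) hle
      ((one_le_upperTauAt_base (by omega) hn h2).trans (hmono _))

theorem cardAtLeast_two_subset : cardAtLeast d 2 ⊆ cardAtLeast d 1 := by
  intro I hI
  simp only [cardAtLeast, Finset.mem_filter, Finset.mem_univ, true_and] at hI ⊢
  omega

theorem lowerTau_cardAtLeast_one (hd : 0 < d) (hn : ∀ k, 2 ≤ n k) :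
    lowerTau n (cardAtLeast d 1) = 0 ∧ LowerAttained n (cardAtLeast d 1) :=
  lowerTau_eq_zero hd hn (k := ⟨0, hd⟩) (by simp [cardAtLeast])

end TensorNuclear

end

/-! ### Assembly of the theorem -/

theorem mainTheorem9 (d : ℕ) (hd : 3 ≤ d) (n : Fin d → ℕ) (hn : ∀ k, 2 ≤ n k) :
    -- basic subspaces and `𝕌`-subspaces
    (∀ I : Finset (Fin d), I.card = 1 → lowerTau n {I} = 0 ∧ upperTau n {I} = 1) ∧
    (∀ I : Finset (Fin d), 2 ≤ I.card → lowerTau n {I} = 1 ∧ upperTau n {I} = 1) ∧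
    (∀ I : Finset (Fin d), I.card = 1 →
      lowerTau n (supersets I) = 0 ∧ upperTau n (supersets I) = 1) ∧
    (∀ I : Finset (Fin d), 2 ≤ I.card →
      lowerTau n (supersets I) = 1 ∧ upperTau n (supersets I) = 1) ∧
    -- order three
    (d = 3 →
      ((1 / 2 : ℝ) : EReal) ≤ lowerTau n (cardAtLeast d 2) ∧
      lowerTau n (cardAtLeast d 2) ≤ ((1 / √3 : ℝ) : EReal) ∧
      ((2 / √3 : ℝ) : EReal) ≤ upperTau n (cardAtLeast d 2) ∧
      upperTau n (cardAtLeast d 2) ≤ (((1 + √2) / 2 : ℝ) : EReal)) ∧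
    (d = 3 →
      lowerTau n (cardAtLeast d 1) = 0 ∧
      ((2 / √3 : ℝ) : EReal) ≤ upperTau n (cardAtLeast d 1) ∧
      upperTau n (cardAtLeast d 1) ≤ ((3 / 2 : ℝ) : EReal)) ∧
    -- order four
    (d = 4 →
      ((1 / 3 : ℝ) : EReal) ≤ lowerTau n (cardAtLeast d 2) ∧
      lowerTau n (cardAtLeast d 2) ≤ ((1 / 2 : ℝ) : EReal) ∧
      (((1 + √2) / 2 : ℝ) : EReal) ≤ upperTau n (cardAtLeast d 2) ∧
      upperTau n (cardAtLeast d 2) ≤ (((1 + √3) / 2 : ℝ) : EReal)) ∧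
    (d = 4 →
      lowerTau n (cardAtLeast d 1) = 0 ∧
      (((1 + √2) / 2 : ℝ) : EReal) ≤ upperTau n (cardAtLeast d 1) ∧
      upperTau n (cardAtLeast d 1) ≤ ((8 / 5 : ℝ) : EReal)) ∧
    -- order at least five
    (5 ≤ d →
      ((2 / ((d : ℝ) * ((d : ℝ) - 1)) : ℝ) : EReal) ≤ lowerTau n (cardAtLeast d 2) ∧
      lowerTau n (cardAtLeast d 2) ≤ ((1 / 2 : ℝ) : EReal) ∧
      (((1 + √2) / 2 : ℝ) : EReal) ≤ upperTau n (cardAtLeast d 2) ∧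
      upperTau n (cardAtLeast d 2) ≤ ((2 : ℝ) : EReal)) ∧
    (5 ≤ d →
      lowerTau n (cardAtLeast d 1) = 0 ∧
      (((1 + √2) / 2 : ℝ) : EReal) ≤ upperTau n (cardAtLeast d 1) ∧
      upperTau n (cardAtLeast d 1) ≤ ((2 : ℝ) : EReal)) ∧
    -- the exact values are attained by some tensor
    (∀ I : Finset (Fin d), 1 ≤ I.card →
      LowerAttained n {I} ∧ UpperAttained n {I} ∧
      LowerAttained n (supersets I) ∧ UpperAttained n (supersets I)) ∧
    LowerAttained n (cardAtLeast d 1) := by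
  have hd0 : 0 < d := by omega
  have hS : ∀ I K : Finset (Fin d), K ∈ ({I} : Finset (Finset (Fin d))) → I ⊆ K :=
    fun I K hK => (Finset.mem_singleton.1 hK).symm.subset
  have hU : ∀ I K : Finset (Fin d), K ∈ supersets I → I ⊆ K := fun I K => subset_of_mem_supersets
  have hIS : ∀ I : Finset (Fin d), I ∈ ({I} : Finset (Finset (Fin d))) :=
    fun I => Finset.mem_singleton_self I
  have hIU : ∀ I : Finset (Fin d), I ∈ supersets I :=
    fun I => singleton_subset_supersets I (Finset.mem_singleton_self I)
  have hlow₀ : ∀ (J : Finset (Finset (Fin d))) (I : Finset (Fin d)), I.card = 1 → I ∈ J →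
      lowerTau n J = 0 ∧ LowerAttained n J := by
    intro J I hI hIJ
    obtain ⟨k, rfl⟩ := Finset.card_eq_one.1 hI
    exact lowerTau_eq_zero hd0 hn hIJ
  have hup₃ : ((2 / √3 : ℝ) : EReal) ≤ upperTau n (cardAtLeast d 2) :=
    (le_upperTauAt_base_of_three hd hn).trans
      (le_iSup (fun T : Tensor n => upperTauAt (cardAtLeast d 2) T) _)
  have hup₄ : 4 ≤ d → (((1 + √2) / 2 : ℝ) : EReal) ≤ upperTau n (cardAtLeast d 2) := fun h4 =>
    (le_upperTauAt_base_of_four h4 hn).trans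
      (le_iSup (fun T : Tensor n => upperTauAt (cardAtLeast d 2) T) _)
  have hlow₄ : 4 ≤ d → lowerTau n (cardAtLeast d 2) ≤ ((1 / 2 : ℝ) : EReal) := fun h4 =>
    (iInf_le (fun T : Tensor n => lowerTauAt (cardAtLeast d 2) T) _).trans
      (lowerTauAt_base_le_of_four h4 hn)
  have hmono : upperTau n (cardAtLeast d 2) ≤ upperTau n (cardAtLeast d 1) :=
    upperTau_mono cardAtLeast_two_subset
  have htwo : ∀ J : Finset (Finset (Fin d)), upperTau n J ≤ ((2 : ℝ) : EReal) := fun J =>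
    iSup_le fun T => upperTauAt_le fun Z hZ hZ1 X _ hZX => specNorm_le_two hd0 hn hZ hZ1 hZX
  have hone := lowerTau_cardAtLeast_one hd0 hn
  refine ⟨fun I hI => ⟨(hlow₀ _ I hI (hIS I)).1, (upperTau_eq_one hd hn hI.ge (hIS I) (hS I)).1⟩,
    fun I hI => ⟨(lowerTau_eq_one hd0 hn hI (hIS I) (hS I)).1,
      (upperTau_eq_one hd hn (by omega) (hIS I) (hS I)).1⟩,
    fun I hI => ⟨(hlow₀ _ I hI (hIU I)).1, (upperTau_eq_one hd hn hI.ge (hIU I) (hU I)).1⟩,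
    fun I hI => ⟨(lowerTau_eq_one hd0 hn hI (hIU I) (hU I)).1,
      (upperTau_eq_one hd hn (by omega) (hIU I) (hU I)).1⟩,
    ?_, ?_, ?_, ?_, ?_, ?_, ?_, hone.2⟩
  · intro h3
    subst h3
    refine ⟨le_iInf fun T => le_lowerTauAt fun Z hZ hZ1 X hX hXt =>
        specNorm_add_le_one_of_order_three hn hZ hZ1 hX hXt,
      (iInf_le (fun T : Tensor n => lowerTauAt (cardAtLeast 3 2) T) _).trans
        (lowerTauAt_base_le_of_three hd hn), hup₃,
      iSup_le fun T => upperTauAt_le fun Z hZ hZ1 X hX hZX =>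
        specNorm_le_of_order_three_of_two hn hZ hZ1 hX hZX⟩
  · intro h3
    subst h3
    exact ⟨hone.1, hup₃.trans hmono, iSup_le fun T => upperTauAt_le fun Z hZ hZ1 X hX hZX =>
      specNorm_le_of_order_three hn hZ hZ1 hX hZX⟩
  · intro h4
    subst h4
    exact ⟨le_iInf fun T => le_lowerTauAt fun Z hZ hZ1 X hX hXt =>
        specNorm_add_le_one_of_order_four hn hZ hZ1 hX hXt,
      hlow₄ le_rfl, hup₄ le_rfl,
      iSup_le fun T => upperTauAt_le fun Z hZ hZ1 X hX hZX =>
        specNorm_le_of_order_four_of_two hn hZ hZ1 hX hZX⟩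
  · intro h4
    subst h4
    exact ⟨hone.1, (hup₄ le_rfl).trans hmono, iSup_le fun T => upperTauAt_le
      fun Z hZ hZ1 X hX hZX => specNorm_le_of_order_four hn hZ hZ1 hX hZX⟩
  · intro h5
    exact ⟨le_iInf fun T => le_lowerTauAt fun Z hZ hZ1 X hX hXt =>
        specNorm_add_le_one_of_pairs (by omega) hn hZ hZ1 hX hXt,
      hlow₄ (by omega), hup₄ (by omega), htwo _⟩
  · intro h5
    exact ⟨hone.1, (hup₄ (by omega)).trans hmono, htwo _⟩
  · intro I hI
    have hlow : ∀ J : Finset (Finset (Fin d)), I ∈ J → (∀ K ∈ J, I ⊆ K) → LowerAttained n J := by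
      intro J hIJ hJ
      rcases hI.eq_or_lt with h1 | h2
      · exact (hlow₀ J I h1.symm hIJ).2
      · exact (lowerTau_eq_one hd0 hn h2 hIJ hJ).2
    exact ⟨hlow _ (hIS I) (hS I), (upperTau_eq_one hd hn hI (hIS I) (hS I)).2,
      hlow _ (hIU I) (hU I), (upperTau_eq_one hd hn hI (hIU I) (hU I)).2⟩
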